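/- Let $a>0$, $b\in\mathbb{R}$, let $p$ be a nonzero real polynomial, and let $\varphi(z)=e^{-az^2+bz}p(z)$. Put $$Q=\Big(\frac{\varphi'}{\varphi}\Big)',\qquad Q_1=\Big(\frac{\varphi''}{\varphi'}\Big)',$$ and let $Z_{\mathbb{R}}(f)$ denote the number of real zeros of a real meromorphic function $f$, counted with multiplicity. Let $E(\varphi')$ be the number of extra zeros of $\varphi'$, counted with multiplicity: between two consecutive real zeros of $\varphi$ the function $\varphi'$ has an odd number $2r+1$ of zeros, of which $2r$ are counted as extra; all zeros of $\varphi'$ to the right of the largest real zero of $\varphi$ or to the left of the smallest one are extra; and if $\varphi$ has no real zeros, then all real zeros of $\varphi'$ are extra. For a real zero $\alpha$ of $\varphi$ let $\beta_1<\alpha<\beta_2$ be the zeros of $\varphi'$ nearest to $\alpha$ on its left and on its right ($\beta_1=-\infty$, respectively $\beta_2=+\infty$, if there is no such zero). Suppose that $\varphi$ has property A: for every real zero $\alpha$ of $\varphi$, the function $Q$ has no zeros in at least one of the intervals $(\beta_1,\alpha)$ and $(\alpha,\beta_2)$. Then $\varphi'$, $Q$ and $Q_1$ have finitely many real zeros,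 and the following holds, where $[x]$ is the integer part of $x$. I. If $p$ has no real zeros, then $$2\left[\frac{E(\varphi')}{2}\right]\le Z_{\mathbb{R}}(Q)\le 2\left[\frac{E(\varphi')}{2}\right]+Z_{\mathbb{R}}(Q_1).$$ II. If $p$ has at least one real zero, then $$2\left[\frac{E(\varphi')}{2}\right]-2\le Z_{\mathbb{R}}(Q)\le 2\left[\frac{E(\varphi')}{2}\right]-2+Z_{\mathbb{R}}(Q_1).$$ -/

import Mathlib

open Polynomial

/-- `f` vanishes at the real point `x`. For a meromorphic `f` the order does not depend on the
value that Lean gives to `f` at a pole or at a removable singularity. -/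
def VanishesAt (f : ℝ → ℝ) (x : ℝ) : Prop :=
  0 < meromorphicOrderAt f x

/-- The multiplicity of the real point `x` as a zero of `f`; it is `0` at regular points where `f`
does not vanish and at poles. A real meromorphic function has the same order at a real point
whether it is regarded as a function on the real line or on the complex plane. -/
noncomputable def zeroMultiplicity (f : ℝ → ℝ) (x : ℝ) : ℕ :=
  (meromorphicOrderAt f x).untop₀.toNat

/-- The number `Z_S(f)` of zeros of `f` in the set `S`, counting multiplicities (meaningful when
`f` has finitely many zeros in `S`). -/
noncomputable def zeroCount (f : ℝ → ℝ) (S : Set ℝ) : ℕ :=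
  ∑ᶠ x ∈ S, zeroMultiplicity f x

/-- `Q[φ] = (φ' / φ)'`. -/
noncomputable def logDerivDeriv (φ : ℝ → ℝ) : ℝ → ℝ :=
  deriv (fun x => deriv φ x / φ x)

/-- Pairs `(a, b)` of consecutive real zeros of `φ`. -/
def consecutiveZeros (φ : ℝ → ℝ) : Set (ℝ × ℝ) :=
  {ab | ab.1 < ab.2 ∧ φ ab.1 = 0 ∧ φ ab.2 = 0 ∧ ∀ x ∈ Set.Ioo ab.1 ab.2, φ x ≠ 0}

/-- The points that lie to the left of all real zeros of `φ` or to the right of all of them; this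
is the whole line when `φ` has no real zeros. -/
def outerPoints (φ : ℝ → ℝ) : Set ℝ :=
  {x | (∀ y, φ y = 0 → x < y) ∨ (∀ y, φ y = 0 → y < x)}

/-- The number `E(φ')` of extra zeros of `φ'`: all but one of the zeros of `φ'` between any two
consecutive zeros of `φ`, and all zeros of `φ'` to the left of all zeros of `φ` or to the right of
all of them. (By Rolle's theorem the subtraction does not truncate.) -/
noncomputable def extraZeros (φ : ℝ → ℝ) : ℕ :=
  (∑ᶠ ab ∈ consecutiveZeros φ, (zeroCount (deriv φ) (Set.Ioo ab.1 ab.2) - 1)) +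
    zeroCount (deriv φ) (outerPoints φ)

/-- The interval `(β₁, α)`, where `β₁ < α` is the zero of `φ'` closest to `α` on its left, and
`β₁ = -∞` if there is no such zero. -/
def leftGap (φ : ℝ → ℝ) (α : ℝ) : Set ℝ :=
  {x | x < α ∧ ∀ y ∈ Set.Ico x α, deriv φ y ≠ 0}

/-- The interval `(α, β₂)`, where `β₂ > α` is the zero of `φ'` closest to `α` on its right, and
`β₂ = +∞` if there is no such zero. -/
def rightGap (φ : ℝ → ℝ) (α : ℝ) : Set ℝ :=
  {x | α < x ∧ ∀ y ∈ Set.Ioc α x, deriv φ y ≠ 0}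

/-- Property A at the real zero `α` of `φ`: `Q[φ]` has no zeros in at least one of the intervals
`(β₁, α)` and `(α, β₂)`. -/
def HasPropertyAAt (φ : ℝ → ℝ) (α : ℝ) : Prop :=
  (∀ x ∈ leftGap φ α, ¬ VanishesAt (logDerivDeriv φ) x) ∨
    (∀ x ∈ rightGap φ α, ¬ VanishesAt (logDerivDeriv φ) x)

/-- Property A: property A at every real zero. -/
def HasPropertyA (φ : ℝ → ℝ) : Prop :=
  ∀ α, φ α = 0 → HasPropertyAAt φ α

/-- The function `z ↦ exp (-a z² + b z) p(z)` on the real line. -/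
noncomputable def gaussPoly (a b : ℝ) (p : ℝ[X]) : ℝ → ℝ :=
  fun x => Real.exp (-a * x ^ 2 + b * x) * p.eval x

section PolynomialForm

open Filter Topology

/-- The polynomial `p₁` with `(exp (-a x² + b x) p)' = exp (-a x² + b x) p₁`. -/
noncomputable def gaussDeriv (a b : ℝ) (p : ℝ[X]) : ℝ[X] :=
  derivative p + (C (-2 * a) * X + C b) * p

/-- The numerator `p² Q[exp (-a x² + b x) p]`. -/
noncomputable def numQ (a : ℝ) (p : ℝ[X]) : ℝ[X] :=
  p * derivative (derivative p) - derivative p ^ 2 - C (2 * a) * p ^ 2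

theorem numQ_eq_wronskian (a b : ℝ) (p : ℝ[X]) :
    numQ a p = p * derivative (gaussDeriv a b p) - derivative p * gaussDeriv a b p := by
  simp only [numQ, gaussDeriv, derivative_add, derivative_mul, derivative_C, derivative_X, C_mul,
    C_neg, map_ofNat, derivative_neg, derivative_ofNat]
  ring

theorem mul_numQ_gaussDeriv (a b : ℝ) (p : ℝ[X]) :
    p * numQ a (gaussDeriv a b p) = gaussDeriv a b p * derivative (numQ a p) +
      ((C (-2 * a) * X + C b) * gaussDeriv a b p - derivative (gaussDeriv a b p)) * numQ a p := by
  simp only [numQ, gaussDeriv, derivative_add, derivative_sub, derivative_mul, derivative_C,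
    derivative_X, C_mul, C_neg, map_ofNat, derivative_pow, derivative_ofNat, derivative_neg]
  simp only [Nat.cast_ofNat, Nat.add_one_sub_one, pow_one, zero_mul, mul_zero, zero_add, add_zero,
    mul_one, neg_zero, map_ofNat, derivative_zero, derivative_one]
  ring

theorem rootMultiplicity_eq_of_eq_pow_mul {f q : ℝ[X]} {x : ℝ} {n : ℕ}
    (h : f = (X - C x) ^ n * q) (hq : q.eval x ≠ 0) : f.rootMultiplicity x = n := by
  have hq0 : q ≠ 0 := by rintro rfl; simp at hq
  have hne : (X - C x) ^ n * q ≠ 0 := mul_ne_zero (pow_ne_zero _ (X_sub_C_ne_zero x)) hq0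
  rw [h, rootMultiplicity_mul hne, rootMultiplicity_X_sub_C_pow, rootMultiplicity_eq_zero hq,
    add_zero]

theorem exists_eq_pow_rootMultiplicity_mul {f : ℝ[X]} (hf : f ≠ 0) (x : ℝ) :
    ∃ q : ℝ[X], f = (X - C x) ^ f.rootMultiplicity x * q ∧ q.eval x ≠ 0 := by
  obtain ⟨q, hq, hd⟩ := exists_eq_pow_rootMultiplicity_mul_and_not_dvd f hf x
  exact ⟨q, hq, fun h => hd (dvd_iff_isRoot.2 h)⟩

theorem factor_at_root (a b : ℝ) {p : ℝ[X]} (hp : p ≠ 0) {x : ℝ} (hx : p.eval x = 0) :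
    ∃ (k : ℕ) (r s t : ℝ[X]), p.rootMultiplicity x = k + 1 ∧
      (numQ a p = (X - C x) ^ (2 * k) * r ∧ r.eval x < 0) ∧
      (gaussDeriv a b p = (X - C x) ^ k * s ∧ s.eval x ≠ 0) ∧
      (p * gaussDeriv a b p = (X - C x) ^ (2 * k + 1) * t ∧ 0 < t.eval x) := by
  obtain ⟨q, hq, hqx⟩ := exists_eq_pow_rootMultiplicity_mul hp x
  obtain ⟨k, hk⟩ : ∃ k, p.rootMultiplicity x = k + 1 :=
    Nat.exists_eq_add_of_lt ((rootMultiplicity_pos hp).2 hx) |>.imp fun k h => by omega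
  rw [hk] at hq
  have hk0 : (0 : ℝ) < k + 1 := by positivity
  set Y : ℝ[X] := X - C x with hY
  have dY : derivative Y = 1 := by simp [hY]
  have eY : Y.eval x = 0 := by simp [hY]
  set l : ℝ[X] := C (-2 * a) * X + C b with hl
  set s : ℝ[X] := C ((k : ℝ) + 1) * q + Y * (derivative q + l * q) with hs
  have dp : derivative p = Y ^ k * (C ((k : ℝ) + 1) * q + Y * derivative q) := by
    rw [hq, derivative_mul, derivative_pow, dY]
    simp only [Nat.cast_add, Nat.cast_one, add_tsub_cancel_right, pow_succ, C_add, C_1]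
    ring
  have hp1 : gaussDeriv a b p = Y ^ k * s := by
    rw [gaussDeriv, dp, ← hl, hs]
    conv_lhs => rw [hq]
    ring
  have dp1 : Y * derivative (Y ^ k * s) = Y ^ k * (C (k : ℝ) * s + Y * derivative s) := by
    rw [derivative_mul, derivative_pow, dY]
    rcases k with _ | k
    · simp
    · simp only [Nat.add_one_sub_one, pow_succ]
      ring
  have sx : s.eval x = (k + 1) * q.eval x := by simp [hs, eY]
  refine ⟨k, -(q * s) + Y * (q * derivative s - (derivative q) * s), s, q * s, hk,
    ⟨?_, ?_⟩, ⟨hp1, ?_⟩, ?_, ?_⟩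
  · have hY0 : Y ≠ 0 := X_sub_C_ne_zero x
    apply mul_left_cancel₀ hY0
    rw [numQ_eq_wronskian a b, hp1, mul_sub, mul_left_comm, dp1, dp]
    conv_lhs => rw [hq]
    simp only [C_add, C_1]
    ring
  · simp only [eval_add, eval_neg, eval_mul, eY, sx, zero_mul, add_zero]
    have := mul_pos hk0 (mul_self_pos.2 hqx)
    linarith
  · rw [sx]; exact mul_ne_zero hk0.ne' hqx
  · rw [hp1]
    conv_lhs => rw [hq]
    ring
  · rw [eval_mul, sx]
    have := mul_pos hk0 (mul_self_pos.2 hqx)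
    linarith

theorem rootMultiplicity_gaussDeriv (a b : ℝ) {p : ℝ[X]} (hp : p ≠ 0) {x : ℝ}
    (hx : p.eval x = 0) :
    (gaussDeriv a b p).rootMultiplicity x + 1 = p.rootMultiplicity x := by
  obtain ⟨k, r, s, t, hk, -, ⟨h1, h2⟩, -⟩ := factor_at_root a b hp hx
  rw [hk, rootMultiplicity_eq_of_eq_pow_mul h1 h2]

theorem eventually_eval_neg {r : ℝ[X]} {x : ℝ} (h : r.eval x < 0) :
    ∀ᶠ y in 𝓝[≠] x, r.eval y < 0 :=
  (r.continuous.continuousAt.eventually_lt continuousAt_const h).filter_mono nhdsWithin_le_nhds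

theorem numQ_eventually_neg (a : ℝ) {p : ℝ[X]} (hp : p ≠ 0) {x : ℝ} (hx : p.eval x = 0) :
    ∀ᶠ y in 𝓝[≠] x, (numQ a p).eval y < 0 := by
  obtain ⟨k, r, s, t, hk, ⟨h1, h2⟩, -⟩ := factor_at_root a 0 hp hx
  filter_upwards [eventually_eval_neg h2, self_mem_nhdsWithin] with y hy hyx
  rw [h1, eval_mul, eval_pow, eval_sub, eval_X, eval_C, pow_mul]
  have : 0 < ((y - x) ^ 2) ^ k := pow_pos (sq_pos_of_ne_zero (sub_ne_zero.2 hyx)) _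
  exact mul_neg_of_pos_of_neg this hy

theorem mul_gaussDeriv_eventually (a b : ℝ) {p : ℝ[X]} (hp : p ≠ 0) {x : ℝ}
    (hx : p.eval x = 0) :
    ∀ᶠ y in 𝓝[≠] x, 0 < (y - x) * (p.eval y * (gaussDeriv a b p).eval y) := by
  obtain ⟨k, r, s, t, hk, -, -, ⟨h1, h2⟩⟩ := factor_at_root a b hp hx
  have h3 : (-t).eval x < 0 := by simpa using h2
  filter_upwards [eventually_eval_neg h3, self_mem_nhdsWithin] with y hy hyx
  rw [← eval_mul, h1, eval_mul, eval_pow, eval_sub, eval_X, eval_C, pow_succ, pow_mul]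
  have h4 : 0 < ((y - x) ^ 2) ^ k := pow_pos (sq_pos_of_ne_zero (sub_ne_zero.2 hyx)) _
  have h5 : 0 < (y - x) ^ 2 := sq_pos_of_ne_zero (sub_ne_zero.2 hyx)
  have h6 : 0 < t.eval y := by simpa using hy
  calc 0 < ((y - x) ^ 2) ^ k * (y - x) ^ 2 * t.eval y := by positivity
    _ = _ := by ring

theorem degree_linear_mul {a b : ℝ} (ha : 0 < a) {p : ℝ[X]} (hp : p ≠ 0) :
    p.degree < ((C (-2 * a) * X + C b) * p).degree := by
  have h2a : -2 * a ≠ 0 := by linarith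
  rw [degree_mul, degree_linear h2a, degree_eq_natDegree hp]
  norm_cast
  omega

theorem leadingCoeff_gaussDeriv {a : ℝ} (b : ℝ) (ha : 0 < a) {p : ℝ[X]} (hp : p ≠ 0) :
    (gaussDeriv a b p).leadingCoeff = -2 * a * p.leadingCoeff := by
  have h2a : -2 * a ≠ 0 := by linarith
  rw [gaussDeriv, leadingCoeff_add_of_degree_lt
    ((degree_derivative_lt hp).trans (degree_linear_mul ha hp)), leadingCoeff_mul,
    leadingCoeff_linear h2a]

theorem gaussDeriv_ne_zero {a : ℝ} (b : ℝ) (ha : 0 < a) {p : ℝ[X]} (hp : p ≠ 0) :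
    gaussDeriv a b p ≠ 0 := by
  rw [← leadingCoeff_ne_zero, leadingCoeff_gaussDeriv b ha hp]
  exact mul_ne_zero (by linarith) (leadingCoeff_ne_zero.2 hp)

theorem natDegree_gaussDeriv {a : ℝ} (b : ℝ) (ha : 0 < a) {p : ℝ[X]} (hp : p ≠ 0) :
    (gaussDeriv a b p).natDegree = p.natDegree + 1 := by
  have h2a : -2 * a ≠ 0 := by linarith
  have h : (gaussDeriv a b p).degree = ((C (-2 * a) * X + C b) * p).degree :=
    degree_add_eq_right_of_degree_lt ((degree_derivative_lt hp).trans (degree_linear_mul ha hp))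
  have hl : C (-2 * a) * X + C b ≠ 0 := fun h0 =>
    h2a (by rw [← leadingCoeff_linear (b := b) h2a, h0, leadingCoeff_zero])
  rw [natDegree_eq_of_degree_eq h, natDegree_mul hl hp, natDegree_linear h2a, add_comm]

theorem leadingCoeff_numQ {a : ℝ} (ha : 0 < a) {p : ℝ[X]} (hp : p ≠ 0) :
    (numQ a p).leadingCoeff = -(2 * a * p.leadingCoeff ^ 2) := by
  have h2a : 2 * a ≠ 0 := by linarith
  have hd : (C (2 * a) * p ^ 2).degree = (p * p).degree := by
    rw [degree_C_mul h2a, sq]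
  have hpb : p.degree ≠ ⊥ := degree_ne_bot.2 hp
  have h1 : (p * derivative (derivative p)).degree < (p * p).degree := by
    rw [degree_mul, degree_mul]
    exact WithBot.add_lt_add_left hpb
      ((degree_derivative_le (p := derivative p)).trans_lt (degree_derivative_lt hp))
  have h2 : (derivative p ^ 2).degree < (p * p).degree := by
    rw [sq, degree_mul, degree_mul]
    exact (add_le_add_left (degree_derivative_lt hp).le _).trans_lt
      (WithBot.add_lt_add_left hpb (degree_derivative_lt hp))
  rw [numQ, sub_eq_add_neg, leadingCoeff_add_of_degree_lt, leadingCoeff_neg, leadingCoeff_mul,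
    leadingCoeff_C, leadingCoeff_pow]
  rw [degree_neg, hd]
  exact (degree_sub_le _ _).trans_lt (max_lt h1 h2)

theorem numQ_ne_zero {a : ℝ} (ha : 0 < a) {p : ℝ[X]} (hp : p ≠ 0) : numQ a p ≠ 0 := by
  rw [← leadingCoeff_ne_zero, leadingCoeff_numQ ha hp]
  have := leadingCoeff_ne_zero.2 hp
  exact neg_ne_zero.2 (by positivity)

theorem eventually_atTop_eval_neg {f : ℝ[X]} (hf : f.leadingCoeff < 0) :
    ∀ᶠ x in atTop, f.eval x < 0 := by
  rcases lt_or_ge 0 f.degree with h | h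
  · exact (tendsto_atBot_of_leadingCoeff_nonpos f h hf.le).eventually_lt_atBot 0
  · rw [eq_C_of_degree_le_zero h, leadingCoeff_C] at hf
    rw [eq_C_of_degree_le_zero h]
    exact Eventually.of_forall fun _ => by simpa using hf

theorem numQ_eventually_atTop {a : ℝ} (ha : 0 < a) {p : ℝ[X]} (hp : p ≠ 0) :
    ∀ᶠ x in atTop, (numQ a p).eval x < 0 := by
  apply eventually_atTop_eval_neg
  rw [leadingCoeff_numQ ha hp]
  have := leadingCoeff_ne_zero.2 hp
  exact neg_neg_of_pos (by positivity)

theorem mul_gaussDeriv_eventually_atTop {a : ℝ} (b : ℝ) (ha : 0 < a) {p : ℝ[X]} (hp : p ≠ 0) :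
    ∀ᶠ x in atTop, p.eval x * (gaussDeriv a b p).eval x < 0 := by
  have h : (p * gaussDeriv a b p).leadingCoeff < 0 := by
    rw [leadingCoeff_mul, leadingCoeff_gaussDeriv b ha hp]
    have := mul_self_pos.2 (leadingCoeff_ne_zero.2 hp)
    nlinarith
  simpa using eventually_atTop_eval_neg h

theorem comp_neg_X_ne_zero {p : ℝ[X]} (hp : p ≠ 0) : p.comp (-X) ≠ 0 := by
  intro h
  apply hp
  have := congrArg (fun q => q.comp (-X)) h
  simpa [comp_assoc] using this

theorem numQ_comp_neg_X (a : ℝ) (p : ℝ[X]) : numQ a (p.comp (-X)) = (numQ a p).comp (-X) := by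
  simp [numQ, derivative_comp]

theorem gaussDeriv_comp_neg_X (a b : ℝ) (p : ℝ[X]) :
    gaussDeriv a (-b) (p.comp (-X)) = -(gaussDeriv a b p).comp (-X) := by
  simp [gaussDeriv, derivative_comp]
  ring

theorem numQ_eventually_atBot {a : ℝ} (ha : 0 < a) {p : ℝ[X]} (hp : p ≠ 0) :
    ∀ᶠ x in atBot, (numQ a p).eval x < 0 := by
  have := tendsto_neg_atBot_atTop.eventually (numQ_eventually_atTop ha (comp_neg_X_ne_zero hp))
  simpa [numQ_comp_neg_X] using this

theorem mul_gaussDeriv_eventually_atBot {a : ℝ} (b : ℝ) (ha : 0 < a) {p : ℝ[X]} (hp : p ≠ 0) :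
    ∀ᶠ x in atBot, 0 < p.eval x * (gaussDeriv a b p).eval x := by
  have := tendsto_neg_atBot_atTop.eventually
    (mul_gaussDeriv_eventually_atTop (-b) ha (comp_neg_X_ne_zero hp))
  simpa [gaussDeriv_comp_neg_X] using this

theorem rootMultiplicity_numQ_of_gaussDeriv_root {a : ℝ} (b : ℝ) (ha : 0 < a) {p : ℝ[X]}
    (hp : p ≠ 0) {x : ℝ} (hx : p.eval x ≠ 0) (hx1 : (gaussDeriv a b p).eval x = 0) :
    (numQ a p).rootMultiplicity x + 1 = (gaussDeriv a b p).rootMultiplicity x := by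
  have hg := gaussDeriv_ne_zero b ha hp
  obtain ⟨q, hq, hqx⟩ := exists_eq_pow_rootMultiplicity_mul hg x
  obtain ⟨k, hk⟩ : ∃ k, (gaussDeriv a b p).rootMultiplicity x = k + 1 :=
    Nat.exists_eq_add_of_lt ((rootMultiplicity_pos hg).2 hx1) |>.imp fun k h => by omega
  rw [hk] at hq ⊢
  have hW : numQ a p = (X - C x) ^ k *
      (p * (C ((k : ℝ) + 1) * q) + (X - C x) * (p * derivative q - derivative p * q)) := by
    rw [numQ_eq_wronskian a b, hq, derivative_mul, derivative_pow]
    simp only [Nat.cast_add, Nat.cast_one, add_tsub_cancel_right, pow_succ, C_add, C_1,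
      derivative_sub, derivative_X, derivative_C]
    ring
  rw [rootMultiplicity_eq_of_eq_pow_mul hW]
  have hk0 : (k : ℝ) + 1 ≠ 0 := by positivity
  simpa [hqx, hx] using hk0

theorem rootMultiplicity_numQ_le {a : ℝ} (b : ℝ) (ha : 0 < a) {p : ℝ[X]}
    (hp : p ≠ 0) {x : ℝ} (hx : p.eval x ≠ 0) :
    (numQ a p).rootMultiplicity x ≤
      (numQ a (gaussDeriv a b p)).rootMultiplicity x + 1 := by
  set m := (numQ a p).rootMultiplicity x with hm
  have hW1 := numQ_ne_zero ha (gaussDeriv_ne_zero b ha hp)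
  have hd : (X - C x) ^ m ∣ numQ a p := pow_rootMultiplicity_dvd _ _
  have h1 : (X - C x) ^ (m - 1) ∣ p * numQ a (gaussDeriv a b p) := by
    rw [mul_numQ_gaussDeriv]
    exact dvd_add (dvd_mul_of_dvd_right (pow_sub_one_dvd_derivative_of_pow_dvd hd) _)
      (dvd_mul_of_dvd_right ((pow_dvd_pow _ (Nat.sub_le _ _)).trans hd) _)
  have h2 := (le_rootMultiplicity_iff (mul_ne_zero hp hW1)).2 h1
  rw [rootMultiplicity_mul (mul_ne_zero hp hW1), rootMultiplicity_eq_zero hx] at h2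
  omega

theorem exists_eval_eq_zero_of_odd_natDegree {f : ℝ[X]} (hf : Odd f.natDegree) :
    ∃ x, f.eval x = 0 := by
  wlog hl : f.leadingCoeff < 0 generalizing f
  · have h0 : f.leadingCoeff ≠ 0 := by
      rw [leadingCoeff_ne_zero]; rintro rfl; simp at hf
    obtain ⟨x, hx⟩ := this (f := -f) (by simpa using hf)
      (by simpa using lt_of_le_of_ne (not_lt.1 hl) h0.symm)
    exact ⟨x, by simpa using hx⟩
  have h1 := eventually_atTop_eval_neg hl
  have h2 : ∀ᶠ x in atTop, (-f.comp (-X)).eval x < 0 := by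
    apply eventually_atTop_eval_neg
    rw [leadingCoeff_neg, leadingCoeff_comp (by simp), leadingCoeff_neg, leadingCoeff_X,
      hf.neg_one_pow]
    linarith
  obtain ⟨x, hx1, hx2⟩ := (h1.and h2).exists
  have hx3 : 0 < f.eval (-x) := by simpa using hx2
  exact mem_range_of_exists_le_of_exists_ge f.continuous ⟨x, hx1.le⟩ ⟨-x, hx3.le⟩

theorem even_card_roots_add_natDegree {f : ℝ[X]} (hf : f ≠ 0) :
    Even (f.roots.card + f.natDegree) := by
  obtain ⟨q, hq, hdeg, hr⟩ := exists_prod_multiset_X_sub_C_mul f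
  suffices h : Even q.natDegree by
    rw [← hdeg]; obtain ⟨c, hc⟩ := h; exact ⟨f.roots.card + c, by omega⟩
  have hq0 : q ≠ 0 := by rintro rfl; simp at hq; exact hf hq.symm
  by_contra ho
  obtain ⟨x, hx⟩ := exists_eval_eq_zero_of_odd_natDegree (Nat.not_even_iff_odd.1 ho)
  have : x ∈ q.roots := (mem_roots hq0).2 hx
  simp [hr] at this

end PolynomialForm

section Rolle

open Filter Topology Set

theorem hasDerivAt_gaussPoly (a b : ℝ) (p : ℝ[X]) (x : ℝ) :
    HasDerivAt (gaussPoly a b p) (gaussPoly a b (gaussDeriv a b p) x) x := by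
  have h1 : HasDerivAt (fun x : ℝ => -a * x ^ 2 + b * x) (-a * (2 * x) + b) x := by
    refine (((hasDerivAt_pow 2 x).const_mul (-a)).add
      ((hasDerivAt_id x).const_mul b)).congr_deriv ?_
    simp
  refine (h1.exp.mul (p.hasDerivAt x)).congr_deriv ?_
  simp only [gaussPoly, gaussDeriv, eval_add, eval_mul, eval_C, eval_X]
  ring

theorem deriv_gaussPoly (a b : ℝ) (p : ℝ[X]) :
    deriv (gaussPoly a b p) = gaussPoly a b (gaussDeriv a b p) :=
  funext fun x => (hasDerivAt_gaussPoly a b p x).deriv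

theorem gaussPoly_eq_zero_iff {a b : ℝ} {p : ℝ[X]} {x : ℝ} :
    gaussPoly a b p x = 0 ↔ p.eval x = 0 := by
  simp [gaussPoly, Real.exp_ne_zero]

theorem hasDerivAt_gaussDeriv_div (a b : ℝ) (p : ℝ[X]) {x : ℝ} (hx : p.eval x ≠ 0) :
    HasDerivAt (fun y => (gaussDeriv a b p).eval y / p.eval y)
      ((numQ a p).eval x / p.eval x ^ 2) x := by
  refine (((gaussDeriv a b p).hasDerivAt x).div (p.hasDerivAt x) hx).congr_deriv ?_
  rw [numQ_eq_wronskian a b, eval_sub, eval_mul, eval_mul]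
  ring

theorem hasDerivAt_gaussPoly_numQ_div (a b : ℝ) (p : ℝ[X]) {x : ℝ}
    (hx : (gaussDeriv a b p).eval x ≠ 0) :
    HasDerivAt (fun y => gaussPoly a b (numQ a p) y / (gaussDeriv a b p).eval y)
      (gaussPoly a b (p * numQ a (gaussDeriv a b p)) x / (gaussDeriv a b p).eval x ^ 2) x := by
  refine ((hasDerivAt_gaussPoly a b (numQ a p) x).div
    ((gaussDeriv a b p).hasDerivAt x) hx).congr_deriv ?_
  rw [mul_numQ_gaussDeriv]
  congr 1
  have h : (gaussDeriv a b (numQ a p)).eval x =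
      (derivative (numQ a p)).eval x + (-2 * a * x + b) * (numQ a p).eval x := by
    simp [gaussDeriv]
  simp only [gaussPoly, eval_add, eval_mul, eval_sub, h, eval_C, eval_X]
  ring

/-- Rolle's theorem for `exp (-a x² + b x) p`. -/
theorem exists_gaussDeriv_eq_zero (a b : ℝ) {p : ℝ[X]} {x y : ℝ} (hxy : x < y)
    (hx : p.eval x = 0) (hy : p.eval y = 0) : ∃ z ∈ Ioo x y, (gaussDeriv a b p).eval z = 0 := by
  obtain ⟨z, hz, h⟩ := exists_hasDerivAt_eq_zero hxy
    (fun z _ => (hasDerivAt_gaussPoly a b p z).continuousAt.continuousWithinAt)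
    (by rw [gaussPoly_eq_zero_iff.2 hx, gaussPoly_eq_zero_iff.2 hy])
    (fun z _ => hasDerivAt_gaussPoly a b p z)
  exact ⟨z, hz, gaussPoly_eq_zero_iff.1 h⟩

theorem exists_numQ_eq_zero (a b : ℝ) {p : ℝ[X]} {x y : ℝ} (hxy : x < y)
    (hp : ∀ z ∈ Icc x y, p.eval z ≠ 0) (hx : (gaussDeriv a b p).eval x = 0)
    (hy : (gaussDeriv a b p).eval y = 0) : ∃ z ∈ Ioo x y, (numQ a p).eval z = 0 := by
  obtain ⟨z, hz, h⟩ := exists_hasDerivAt_eq_zero hxy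
    (fun z hz => (hasDerivAt_gaussDeriv_div a b p (hp z hz)).continuousAt.continuousWithinAt)
    (by rw [hx, hy, zero_div, zero_div])
    (fun z hz => hasDerivAt_gaussDeriv_div a b p (hp z (Ioo_subset_Icc_self hz)))
  refine ⟨z, hz, ?_⟩
  simpa [hp z (Ioo_subset_Icc_self hz)] using h

theorem eval_mul_eval_pos {f : ℝ[X]} {x y : ℝ} (h : ∀ z ∈ uIcc x y, f.eval z ≠ 0) :
    0 < f.eval x * f.eval y := by
  by_contra hc
  have h0 : (0 : ℝ) ∈ uIcc (f.eval x) (f.eval y) := by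
    rw [mem_uIcc]
    rcases mul_nonpos_iff.1 (not_lt.1 hc) with h | h
    · exact Or.inr ⟨h.2, h.1⟩
    · exact Or.inl h
  obtain ⟨z, hz, hz0⟩ := intermediate_value_uIcc f.continuous.continuousOn h0
  exact h z hz hz0

/-- The mean value theorem for `exp (-a x² + b x) numQ a p / gaussDeriv a b p`, where the positive
factors have been dropped. -/
theorem exists_numQ_gaussDeriv_slope (a b : ℝ) {p : ℝ[X]} {x y : ℝ} (hxy : x < y)
    (hp : ∀ z ∈ Icc x y, p.eval z ≠ 0) (hp1 : ∀ z ∈ Icc x y, (gaussDeriv a b p).eval z ≠ 0) :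
    ∃ z ∈ Ioo x y, ∃ c u v : ℝ, 0 < c ∧ 0 < u ∧ 0 < v ∧
      c * (numQ a (gaussDeriv a b p)).eval z =
        v * ((numQ a p).eval y * (p.eval y * (gaussDeriv a b p).eval y)) -
        u * ((numQ a p).eval x * (p.eval x * (gaussDeriv a b p).eval x)) := by
  obtain ⟨z, hz, h⟩ := exists_hasDerivAt_eq_slope _ _ hxy
    (fun z hz => (hasDerivAt_gaussPoly_numQ_div a b p (hp1 z hz)).continuousAt.continuousWithinAt)
    (fun z hz => hasDerivAt_gaussPoly_numQ_div a b p (hp1 z (Ioo_subset_Icc_self hz)))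
  have hsub : ∀ {s t}, s ∈ Icc x y → t ∈ Icc x y → 0 < p.eval s * p.eval t := fun hs ht =>
    eval_mul_eval_pos fun w hw => hp w (uIcc_subset_Icc hs ht hw)
  have hzI := Ioo_subset_Icc_self hz
  have hxI := left_mem_Icc.2 hxy.le
  have hyI := right_mem_Icc.2 hxy.le
  have h1x := hp1 x hxI
  have h1y := hp1 y hyI
  have h1z := hp1 z hzI
  have h0x := hp x hxI
  have h0y := hp y hyI
  have hd : 0 < y - x := sub_pos.2 hxy
  set e : ℝ → ℝ := fun t => Real.exp (-a * t ^ 2 + b * t) with he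
  have hep : ∀ t, 0 < e t := fun t => Real.exp_pos _
  set P1 := gaussDeriv a b p with hP1
  have hzz := hsub hzI hzI
  have hzx := hsub hzI hxI
  have hzy := hsub hzI hyI
  have hex := hep x
  have hey := hep y
  have hez := hep z
  refine ⟨z, hz, e z * (p.eval z * p.eval z) / P1.eval z ^ 2 * (y - x),
    e x * (p.eval z * p.eval x) / (p.eval x ^ 2 * P1.eval x ^ 2),
    e y * (p.eval z * p.eval y) / (p.eval y ^ 2 * P1.eval y ^ 2),
    by positivity, by positivity, by positivity, ?_⟩
  simp only [gaussPoly, eval_mul] at h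
  have h' := congrArg (fun w => w * (y - x) * p.eval z) h
  simp only [div_mul_cancel₀ _ hd.ne'] at h'
  calc _ = e z * (p.eval z * (numQ a P1).eval z) / P1.eval z ^ 2 * (y - x) * p.eval z := by ring
    _ = _ := h'
    _ = _ := by
      simp only [he]
      field_simp

theorem exists_numQ_gaussDeriv_eq_zero (a b : ℝ) {p : ℝ[X]} {x y : ℝ} (hxy : x < y)
    (hp : ∀ z ∈ Icc x y, p.eval z ≠ 0) (hp1 : ∀ z ∈ Icc x y, (gaussDeriv a b p).eval z ≠ 0)
    (hx : (numQ a p).eval x = 0) (hy : (numQ a p).eval y = 0) :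
    ∃ z ∈ Ioo x y, (numQ a (gaussDeriv a b p)).eval z = 0 := by
  obtain ⟨z, hz, c, u, v, hc, -, -, h⟩ := exists_numQ_gaussDeriv_slope a b hxy hp hp1
  refine ⟨z, hz, ?_⟩
  simpa [hx, hy, hc.ne'] using h

theorem exists_numQ_gaussDeriv_pos_of_right_zero (a b : ℝ) {p : ℝ[X]} {x y : ℝ} (hxy : x < y)
    (hp : ∀ z ∈ Icc x y, p.eval z ≠ 0) (hp1 : ∀ z ∈ Icc x y, (gaussDeriv a b p).eval z ≠ 0)
    (hx : (numQ a p).eval x * (p.eval x * (gaussDeriv a b p).eval x) < 0)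
    (hy : (numQ a p).eval y = 0) :
    ∃ z ∈ Ioo x y, 0 < (numQ a (gaussDeriv a b p)).eval z := by
  obtain ⟨z, hz, c, u, v, hc, hu, hv, h⟩ := exists_numQ_gaussDeriv_slope a b hxy hp hp1
  refine ⟨z, hz, pos_of_mul_pos_right (a := c) ?_ hc.le⟩
  have := mul_neg_of_pos_of_neg hu hx
  rw [h, hy]
  linarith

theorem exists_numQ_gaussDeriv_pos_of_left_zero (a b : ℝ) {p : ℝ[X]} {x y : ℝ} (hxy : x < y)
    (hp : ∀ z ∈ Icc x y, p.eval z ≠ 0) (hp1 : ∀ z ∈ Icc x y, (gaussDeriv a b p).eval z ≠ 0)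
    (hx : (numQ a p).eval x = 0)
    (hy : 0 < (numQ a p).eval y * (p.eval y * (gaussDeriv a b p).eval y)) :
    ∃ z ∈ Ioo x y, 0 < (numQ a (gaussDeriv a b p)).eval z := by
  obtain ⟨z, hz, c, u, v, hc, hu, hv, h⟩ := exists_numQ_gaussDeriv_slope a b hxy hp hp1
  refine ⟨z, hz, pos_of_mul_pos_right (a := c) ?_ hc.le⟩
  have := mul_pos hv hy
  rw [h, hx]
  linarith

/-- A continuous function that is negative around every point of `Z` changes its sign from `-` to
`+` at a zero outside `Z`. -/
theorem exists_zero_notMem_of_neg_of_pos {f : ℝ → ℝ} (hf : Continuous f) {Z : Set ℝ}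
    (hZ : ∀ z ∈ Z, ∀ᶠ y in 𝓝[≠] z, f y < 0) {u v : ℝ} (huv : u < v) (hu : f u < 0)
    (hv : 0 < f v) : ∃ z ∈ Ioo u v, f z = 0 ∧ z ∉ Z := by
  have hc : IsCompact (Icc u v ∩ f ⁻¹' Iic 0) :=
    isCompact_Icc.inter_right (isClosed_Iic.preimage hf)
  obtain ⟨z, ⟨hz, hz0⟩, hmax⟩ := hc.exists_isGreatest ⟨u, left_mem_Icc.2 huv.le, hu.le⟩
  have hzv : z < v := lt_of_le_of_ne hz.2 fun h => not_lt.2 hz0 (h ▸ hv)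
  have hpos : ∀ y ∈ Ioo z v, 0 < f y := fun y hy => by
    by_contra hn
    exact not_lt.2 (hmax ⟨⟨hz.1.trans hy.1.le, hy.2.le⟩, not_lt.1 hn⟩) hy.1
  have hev : ∀ᶠ y in 𝓝[>] z, 0 < f y := by
    filter_upwards [Ioo_mem_nhdsGT hzv] using hpos
  have hz0' : f z = 0 := le_antisymm hz0 <|
    ge_of_tendsto (hf.continuousAt.tendsto.mono_left nhdsWithin_le_nhds)
      (hev.mono fun _ h => h.le)
  refine ⟨z, ⟨lt_of_le_of_ne hz.1 fun h => ?_, hzv⟩, hz0', fun hzZ => ?_⟩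
  · rw [h, hz0'] at hu; exact lt_irrefl _ hu
  · obtain ⟨y, h1, h2⟩ := (((hZ z hzZ).filter_mono
      (nhdsGT_le_nhdsNE z)).and hev).exists
    exact lt_asymm h1 h2

theorem exists_zero_notMem_of_pos_of_neg {f : ℝ → ℝ} (hf : Continuous f) {Z : Set ℝ}
    (hZ : ∀ z ∈ Z, ∀ᶠ y in 𝓝[≠] z, f y < 0) {u v : ℝ} (huv : u < v) (hu : 0 < f u)
    (hv : f v < 0) : ∃ z ∈ Ioo u v, f z = 0 ∧ z ∉ Z := by
  have hneg : ∀ z : ℝ, Tendsto (fun y : ℝ => -y) (𝓝[≠] z) (𝓝[≠] (-z)) := fun z =>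
    tendsto_nhdsWithin_of_tendsto_nhds_of_eventually_within _
      (continuous_neg.continuousAt.tendsto.mono_left nhdsWithin_le_nhds)
      (by filter_upwards [self_mem_nhdsWithin] with y hy h; exact hy (neg_injective h))
  obtain ⟨z, hz, hz0, hzZ⟩ := exists_zero_notMem_of_neg_of_pos (f := fun x => f (-x))
    (hf.comp continuous_neg) (Z := -Z)
    (fun z hz => (hneg z).eventually (hZ (-z) hz)) (neg_lt_neg huv)
    (by simpa using hv) (by simpa using hu)
  exact ⟨-z, ⟨by linarith [hz.2], by linarith [hz.1]⟩, hz0, hzZ⟩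

variable {a b : ℝ} {p : ℝ[X]}

theorem exists_gaussDeriv_root_lt (b : ℝ) (ha : 0 < a) (hp : p ≠ 0) {x : ℝ} (hx : p.eval x = 0) :
    ∃ y < x, (gaussDeriv a b p).eval y = 0 := by
  by_contra! hc
  have hp0 : ∀ y < x, p.eval y ≠ 0 := fun y hy h => by
    obtain ⟨z, hz, hz0⟩ := exists_gaussDeriv_eq_zero a b hy h hx
    exact hc z hz.2 hz0
  obtain ⟨u, hu, hux⟩ :=
    ((mul_gaussDeriv_eventually_atBot b ha hp).and (eventually_lt_atBot x)).exists
  obtain ⟨v, hv, hvx⟩ := (((mul_gaussDeriv_eventually a b hp hx).filter_mono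
    (nhdsLT_le_nhdsNE x)).and self_mem_nhdsWithin).exists
  have hvx : v < x := hvx
  have h := eval_mul_eval_pos (f := p * gaussDeriv a b p) (x := u) (y := v) fun z hz => by
    have : z < x := (uIcc_subset_Icc (a₂ := min u v) (b₂ := max u v)
      (by simp) (by simp) hz).2.trans_lt (max_lt hux hvx)
    rw [eval_mul]
    exact mul_ne_zero (hp0 z this) (hc z this)
  rw [eval_mul, eval_mul] at h
  have h1 := (mul_pos_iff_of_pos_left hu).1 h
  linarith [mul_neg_of_neg_of_pos (sub_neg.2 hvx) h1]

theorem exists_last_gaussDeriv_root_lt (b : ℝ) (ha : 0 < a) (hp : p ≠ 0) {x : ℝ}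
    (hx : p.eval x = 0) :
    ∃ y < x, (gaussDeriv a b p).eval y = 0 ∧ p.eval y ≠ 0 ∧
      ∀ z ∈ Ioo y x, (gaussDeriv a b p).eval z ≠ 0 := by
  obtain ⟨u, hu, hu0⟩ := exists_gaussDeriv_root_lt b ha hp hx
  have hg := gaussDeriv_ne_zero b ha hp
  obtain ⟨y, hy, hmax⟩ := ((gaussDeriv a b p).roots.toFinset.filter (· < x)).exists_max_image id
    ⟨u, by simp [hg, hu, hu0]⟩
  simp only [Finset.mem_filter, Multiset.mem_toFinset, mem_roots hg, IsRoot.def, id] at hy hmax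
  have hno : ∀ z ∈ Ioo y x, (gaussDeriv a b p).eval z ≠ 0 := fun z hz h =>
    not_lt.2 (hmax z ⟨h, hz.2⟩) hz.1
  refine ⟨y, hy.2, hy.1, fun h => ?_, hno⟩
  obtain ⟨z, hz, hz0⟩ := exists_gaussDeriv_eq_zero a b hy.2 h hx
  exact hno z hz hz0

theorem exists_first_gaussDeriv_root_gt (b : ℝ) (ha : 0 < a) (hp : p ≠ 0) {x : ℝ}
    (hx : p.eval x = 0) :
    ∃ y > x, (gaussDeriv a b p).eval y = 0 ∧ p.eval y ≠ 0 ∧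
      ∀ z ∈ Ioo x y, (gaussDeriv a b p).eval z ≠ 0 := by
  obtain ⟨y, hy, h, h1, h2⟩ := exists_last_gaussDeriv_root_lt (-b) ha (comp_neg_X_ne_zero hp)
    (x := -x) (by simpa using hx)
  refine ⟨-y, by linarith, by simpa [gaussDeriv_comp_neg_X] using h, by simpa using h1,
    fun z hz => ?_⟩
  have := h2 (-z) ⟨by linarith [hz.2], by linarith [hz.1]⟩
  simpa [gaussDeriv_comp_neg_X] using this

theorem exists_gaussDeriv_root_of_no_root (b : ℝ) (ha : 0 < a) (hp : p ≠ 0)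
    (h : ∀ x, p.eval x ≠ 0) : ∃ x, (gaussDeriv a b p).eval x = 0 := by
  apply exists_eval_eq_zero_of_odd_natDegree
  rw [natDegree_gaussDeriv b ha hp]
  refine Even.add_one (Nat.not_odd_iff_even.1 fun ho => ?_)
  obtain ⟨x, hx⟩ := exists_eval_eq_zero_of_odd_natDegree ho
  exact h x hx

end Rolle

section Counting

open Filter Topology Set

variable {a b : ℝ} {p : ℝ[X]}

theorem numQ_neg (a : ℝ) (p : ℝ[X]) : numQ a (-p) = numQ a p := by
  simp [numQ]

theorem exists_numQ_gaussDeriv_zero_of_root_mem_Ioo (ha : 0 < a) (hp : p ≠ 0) {x s y : ℝ}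
    (hx : p.eval x = 0) (hsx : s < x) (hs : (numQ a (gaussDeriv a b p)).eval s < 0)
    (hxy : x < y) (h1 : ∀ z ∈ Ioc x y, (gaussDeriv a b p).eval z ≠ 0)
    (hy : (numQ a p).eval y = 0) :
    ∃ z ∈ Ioo s y, (numQ a (gaussDeriv a b p)).eval z = 0 ∧ (gaussDeriv a b p).eval z ≠ 0 := by
  have hg := gaussDeriv_ne_zero b ha hp
  obtain ⟨t, ⟨ht1, ht2⟩, hxt, hty⟩ := ((((numQ_eventually_neg a hp hx).and
    (mul_gaussDeriv_eventually a b hp hx)).filter_mono (nhdsGT_le_nhdsNE x)).and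
    (Ioo_mem_nhdsGT hxy)).exists
  have hp0 : ∀ z ∈ Icc t y, p.eval z ≠ 0 := fun z hz h => by
    obtain ⟨w, hw, hw0⟩ := exists_gaussDeriv_eq_zero a b (hxt.trans_le hz.1) hx h
    exact h1 w ⟨hw.1, hw.2.le.trans hz.2⟩ hw0
  obtain ⟨w, hw, hw0⟩ := exists_numQ_gaussDeriv_pos_of_right_zero a b hty hp0
    (fun z hz => h1 z ⟨hxt.trans_le hz.1, hz.2⟩)
    (mul_neg_of_neg_of_pos ht1 (pos_of_mul_pos_right ht2 (sub_pos.2 hxt).le)) hy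
  obtain ⟨z, hz, hz0, hz1⟩ := exists_zero_notMem_of_neg_of_pos
    (numQ a (gaussDeriv a b p)).continuous (Z := {z | (gaussDeriv a b p).eval z = 0})
    (fun z hz => numQ_eventually_neg a hg hz) ((hsx.trans hxt).trans hw.1) hs hw0
  exact ⟨z, ⟨hz.1, hz.2.trans hw.2⟩, hz0, hz1⟩

theorem exists_numQ_gaussDeriv_zero_of_root_mem_Ioo' (ha : 0 < a) (hp : p ≠ 0) {x s y : ℝ}
    (hx : p.eval x = 0) (hxs : x < s) (hs : (numQ a (gaussDeriv a b p)).eval s < 0)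
    (hyx : y < x) (h1 : ∀ z ∈ Ico y x, (gaussDeriv a b p).eval z ≠ 0)
    (hy : (numQ a p).eval y = 0) :
    ∃ z ∈ Ioo y s, (numQ a (gaussDeriv a b p)).eval z = 0 ∧ (gaussDeriv a b p).eval z ≠ 0 := by
  obtain ⟨z, hz, h⟩ := exists_numQ_gaussDeriv_zero_of_root_mem_Ioo (b := -b) ha
    (comp_neg_X_ne_zero hp) (x := -x) (s := -s) (y := -y) (by simpa using hx) (neg_lt_neg hxs)
    (by simpa [gaussDeriv_comp_neg_X, numQ_neg, numQ_comp_neg_X] using hs) (neg_lt_neg hyx)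
    (fun z hz => by
      have := h1 (-z) ⟨by linarith [hz.2], by linarith [hz.1]⟩
      simpa [gaussDeriv_comp_neg_X] using this)
    (by simpa [numQ_comp_neg_X] using hy)
  refine ⟨-z, ⟨by linarith [hz.2], by linarith [hz.1]⟩, ?_⟩
  simpa [gaussDeriv_comp_neg_X, numQ_neg, numQ_comp_neg_X] using h

/-- The roots of `f` that are not roots of `g`. -/
noncomputable def rootsAwayFrom (f g : ℝ[X]) : Finset ℝ :=
  f.roots.toFinset.filter fun x => g.eval x ≠ 0

theorem mem_rootsAwayFrom {f g : ℝ[X]} (hf : f ≠ 0) {x : ℝ} :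
    x ∈ rootsAwayFrom f g ↔ f.eval x = 0 ∧ g.eval x ≠ 0 := by
  simp [rootsAwayFrom, hf]

/-- Property A for `exp (-a x² + b x) p` in terms of polynomials. -/
def PolyPropertyA (a b : ℝ) (p : ℝ[X]) : Prop :=
  ∀ x, p.eval x = 0 →
    (∀ y < x, (∀ z ∈ Ico y x, (gaussDeriv a b p).eval z ≠ 0) →
      (numQ a p).eval y = 0 → p.eval y = 0) ∨
    (∀ y > x, (∀ z ∈ Ioc x y, (gaussDeriv a b p).eval z ≠ 0) →
      (numQ a p).eval y = 0 → p.eval y = 0)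

theorem exists_marker (ha : 0 < a) (hp : p ≠ 0) (hA : PolyPropertyA a b p) {x : ℝ}
    (hx : p.eval x = 0) :
    ∃ s, (numQ a (gaussDeriv a b p)).eval s < 0 ∧
      ((s < x ∧ (∀ z ∈ Ico s x, (gaussDeriv a b p).eval z ≠ 0) ∧
        ∀ y < x, (∀ z ∈ Ico y x, (gaussDeriv a b p).eval z ≠ 0) →
          (numQ a p).eval y = 0 → p.eval y = 0) ∨
      (x < s ∧ (∀ z ∈ Ioc x s, (gaussDeriv a b p).eval z ≠ 0) ∧
        ∀ y > x, (∀ z ∈ Ioc x y, (gaussDeriv a b p).eval z ≠ 0) →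
          (numQ a p).eval y = 0 → p.eval y = 0)) := by
  have hg := gaussDeriv_ne_zero b ha hp
  rcases hA x hx with h | h
  · obtain ⟨y, hyx, hy, -, h1⟩ := exists_last_gaussDeriv_root_lt b ha hp hx
    obtain ⟨s, hs, hys, hsx⟩ := (((numQ_eventually_neg a hg hy).filter_mono
      (nhdsGT_le_nhdsNE y)).and (Ioo_mem_nhdsGT hyx)).exists
    exact ⟨s, hs, Or.inl ⟨hsx, fun z hz => h1 z ⟨hys.trans_le hz.1, hz.2⟩, h⟩⟩
  · obtain ⟨y, hyx, hy, -, h1⟩ := exists_first_gaussDeriv_root_gt b ha hp hx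
    obtain ⟨s, hs, hsx, hys⟩ := (((numQ_eventually_neg a hg hy).filter_mono
      (nhdsLT_le_nhdsNE y)).and (Ioo_mem_nhdsLT hyx)).exists
    exact ⟨s, hs, Or.inr ⟨hsx, fun z hz => h1 z ⟨hz.1, hz.2.trans_lt hys⟩, h⟩⟩

theorem card_zeros_numQ_add_le (ha : 0 < a) (hp : p ≠ 0) (hA : PolyPropertyA a b p) :
    (rootsAwayFrom (numQ a p) (p * gaussDeriv a b p)).card + p.roots.toFinset.card + 1 ≤
      (rootsAwayFrom (gaussDeriv a b p) p).card +
        (rootsAwayFrom (numQ a (gaussDeriv a b p)) (gaussDeriv a b p) \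
          rootsAwayFrom (numQ a p) (p * gaussDeriv a b p)).card := by
  classical
  have hg := gaussDeriv_ne_zero b ha hp
  have hW := numQ_ne_zero ha hp
  have hW1 := numQ_ne_zero ha hg
  set g := gaussDeriv a b p with hg_def
  set S₀ := rootsAwayFrom (numQ a p) (p * g) with hS₀
  set R := rootsAwayFrom g p with hR
  set Z := rootsAwayFrom (numQ a g) g with hZ
  have mS : ∀ {x}, x ∈ S₀ ↔ (numQ a p).eval x = 0 ∧ p.eval x ≠ 0 ∧ g.eval x ≠ 0 := fun {x} => by
    rw [hS₀, mem_rootsAwayFrom hW, eval_mul, mul_ne_zero_iff]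
  have mR : ∀ {x}, x ∈ R ↔ g.eval x = 0 ∧ p.eval x ≠ 0 := mem_rootsAwayFrom hg
  have mZ : ∀ {x}, x ∈ Z ↔ (numQ a g).eval x = 0 ∧ g.eval x ≠ 0 := mem_rootsAwayFrom hW1
  have hZg : ∀ z ∈ {z | g.eval z = 0}, ∀ᶠ y in 𝓝[≠] z, (numQ a g).eval y < 0 :=
    fun z hz => numQ_eventually_neg a hg hz
  have mA : ∀ {x}, x ∈ p.roots.toFinset ↔ p.eval x = 0 := fun {x} => by simp [hp]
  choose! l hlx hlg hlp hl using fun x (hx : p.eval x = 0) =>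
    exists_last_gaussDeriv_root_lt b ha hp hx
  choose! r hrx hrg hrp hr using fun x (hx : p.eval x = 0) =>
    exists_first_gaussDeriv_root_gt b ha hp hx
  choose! s hs hs' using fun x (hx : p.eval x = 0) => exists_marker ha hp hA hx
  simp only [← hg_def] at hlg hl hrg hr hs hs'
  have hls : ∀ x, p.eval x = 0 → l x < s x := fun x hx => by
    rcases hs' x hx with h | h
    · by_contra hn
      exact h.2.1 (l x) ⟨not_lt.1 hn, hlx x hx⟩ (hlg x hx)
    · exact (hlx x hx).trans h.1
  have hsr : ∀ x, p.eval x = 0 → s x < r x := fun x hx => by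
    rcases hs' x hx with h | h
    · exact h.1.trans (hrx x hx)
    · by_contra hn
      exact h.2.1 (r x) ⟨hrx x hx, not_lt.1 hn⟩ (hrg x hx)
  have hrl : ∀ x y, p.eval x = 0 → p.eval y = 0 → x < y → r x ≤ l y := fun x y hx hy hxy => by
    obtain ⟨z, hz, hz0⟩ := exists_gaussDeriv_eq_zero a b hxy hx hy
    have h1 : r x ≤ z := not_lt.1 fun h => hr x hx z ⟨hz.1, h⟩ hz0
    have h2 : z ≤ l y := not_lt.1 fun h => hl y hy z ⟨h, hz.2⟩ hz0
    exact h1.trans h2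
  have hss : ∀ x y, p.eval x = 0 → p.eval y = 0 → x < y → s x < s y := fun x y hx hy hxy =>
    ((hsr x hx).trans_le (hrl x y hx hy hxy)).trans (hls y hy)
  have hsS : ∀ x, p.eval x = 0 → s x ∉ S₀ := fun x hx hsx => by
    obtain ⟨h0, h1, -⟩ := mS.1 hsx
    rcases hs' x hx with h | h
    · exact h1 (h.2.2 _ h.1 h.2.1 h0)
    · exact h1 (h.2.2 _ h.1 h.2.1 h0)
  have hRne : ∃ x, x ∈ R := by
    by_cases hroot : ∃ x, p.eval x = 0
    · obtain ⟨x, hx⟩ := hroot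
      exact ⟨l x, mR.2 ⟨hlg x hx, hlp x hx⟩⟩
    · push Not at hroot
      obtain ⟨x, hx⟩ := exists_gaussDeriv_root_of_no_root b ha hp hroot
      exact ⟨x, mR.2 ⟨hx, hroot x⟩⟩
  set F : Finset ℝ := (S₀ ∪ p.roots.toFinset.image s) ∪ R with hF
  have hFb : ∀ᶠ x in atBot, ∀ y ∈ F, x < y :=
    (eventually_all_finset F).2 fun y _ => eventually_lt_atBot y
  have hFt : ∀ᶠ x in atTop, ∀ y ∈ F, y < x :=
    (eventually_all_finset F).2 fun y _ => eventually_gt_atTop y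
  obtain ⟨km, hkmF, hkmW, hkmW1, hkmg⟩ := (hFb.and ((numQ_eventually_atBot ha hp).and
    ((numQ_eventually_atBot ha hg).and (mul_gaussDeriv_eventually_atBot b ha hp)))).exists
  obtain ⟨kp, hkpF, hkpW, hkpW1, hkpg⟩ := (hFt.and ((numQ_eventually_atTop ha hp).and
    ((numQ_eventually_atTop ha hg).and (mul_gaussDeriv_eventually_atTop b ha hp)))).exists
  have hFS : ∀ {x}, x ∈ S₀ → x ∈ F := fun h => by simp [hF, h]
  have hFR : ∀ {x}, x ∈ R → x ∈ F := fun h => by simp [hF, h]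
  have hFs : ∀ {x}, p.eval x = 0 → s x ∈ F := fun {x} h => by
    rw [hF, Finset.mem_union, Finset.mem_union]
    exact Or.inl (Or.inr (Finset.mem_image_of_mem s (mA.2 h)))
  have lR : ∀ {x}, p.eval x = 0 → l x ∈ R := fun {x} hx => mR.2 ⟨hlg x hx, hlp x hx⟩
  have rR : ∀ {x}, p.eval x = 0 → r x ∈ R := fun {x} hx => mR.2 ⟨hrg x hx, hrp x hx⟩
  set S : Finset ℝ := insert km (insert kp (S₀ ∪ p.roots.toFinset.image s)) with hS
  have key : S.card ≤ ((R ∪ Z) \ S).card + 1 := by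
    refine Finset.card_le_sdiff_of_interleaved fun x hx y hy hxy _ => ?_
    by_cases hno : ∃ z ∈ R, x < z ∧ z < y
    · obtain ⟨z, hz, h⟩ := hno
      exact ⟨z, Finset.mem_union_left _ hz, h⟩
    push Not at hno
    suffices h : ∃ z ∈ Ioo x y, (numQ a g).eval z = 0 ∧ g.eval z ≠ 0 by
      obtain ⟨z, hz, h⟩ := h
      exact ⟨z, Finset.mem_union_right _ (mZ.2 h), hz⟩
    have hfree : (∀ z ∈ Icc x y, p.eval z ≠ 0) → g.eval x ≠ 0 → g.eval y ≠ 0 →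
        ∀ z ∈ Icc x y, g.eval z ≠ 0 := fun h h1 h2 z hz h0 => by
      have hzx : x < z := lt_of_le_of_ne hz.1 fun h => h1 (h ▸ h0)
      have hzy : z < y := lt_of_le_of_ne hz.2 fun h => h2 (h ▸ h0)
      exact absurd hzy (not_lt.2 (hno z (mR.2 ⟨h0, h z hz⟩) hzx))
    have hkmne : p.eval km ≠ 0 ∧ g.eval km ≠ 0 := mul_ne_zero_iff.1 hkmg.ne'
    have hkpne : p.eval kp ≠ 0 ∧ g.eval kp ≠ 0 := mul_ne_zero_iff.1 hkpg.ne
    simp only [hS, Finset.mem_insert, Finset.mem_union, Finset.mem_image, mA] at hx hy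
    rcases hx with rfl | rfl | hx | ⟨u, hu, rfl⟩
    · rcases hy with rfl | rfl | hy | ⟨v, hv, rfl⟩
      · exact absurd hxy (lt_irrefl _)
      · obtain ⟨z, hz⟩ := hRne
        exact absurd (hkpF z (hFR hz)) (not_lt.2 (hno z hz (hkmF z (hFR hz))))
      · obtain ⟨hy0, hyp, hyg⟩ := mS.1 hy
        have hp0 : ∀ z ∈ Icc x y, p.eval z ≠ 0 := fun z hz h =>
          absurd ((hlx z h).trans_le hz.2) (not_lt.2 (hno _ (lR h) (hkmF _ (hFR (lR h)))))
        obtain ⟨w, hw, hw0⟩ := exists_numQ_gaussDeriv_pos_of_right_zero a b hxy hp0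
          (hfree hp0 hkmne.2 hyg) (mul_neg_of_neg_of_pos hkmW hkmg) hy0
        obtain ⟨z, hz, h⟩ := exists_zero_notMem_of_neg_of_pos (numQ a g).continuous hZg hw.1
          hkmW1 hw0
        exact ⟨z, ⟨hz.1, hz.2.trans hw.2⟩, h⟩
      · exact absurd (hls v hv) (not_lt.2 (hno _ (lR hv) (hkmF _ (hFR (lR hv)))))
    · rcases hy with rfl | rfl | hy | ⟨v, hv, rfl⟩
      · obtain ⟨z, hz⟩ := hRne
        exact absurd ((hkmF z (hFR hz)).trans (hkpF z (hFR hz))) hxy.not_gt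
      · exact absurd hxy (lt_irrefl _)
      · exact absurd (hkpF y (hFS hy)) hxy.not_gt
      · exact absurd (hkpF _ (hFs hv)) hxy.not_gt
    · obtain ⟨hx0, hxp, hxg⟩ := mS.1 hx
      rcases hy with rfl | rfl | hy | ⟨v, hv, rfl⟩
      · exact absurd (hkmF x (hFS hx)) hxy.not_gt
      · have hp0 : ∀ z ∈ Icc x y, p.eval z ≠ 0 := fun z hz h =>
          absurd (hkpF _ (hFR (rR h))) (not_lt.2 (hno _ (rR h) (hz.1.trans_lt (hrx z h))))
        obtain ⟨w, hw, hw0⟩ := exists_numQ_gaussDeriv_pos_of_left_zero a b hxy hp0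
          (hfree hp0 hxg hkpne.2) hx0 (mul_pos_of_neg_of_neg hkpW hkpg)
        obtain ⟨z, hz, h⟩ := exists_zero_notMem_of_pos_of_neg (numQ a g).continuous hZg hw.2
          hw0 hkpW1
        exact ⟨z, ⟨hw.1.trans hz.1, hz.2⟩, h⟩
      · obtain ⟨hy0, hyp, hyg⟩ := mS.1 hy
        have hp0 : ∀ z ∈ Icc x y, p.eval z ≠ 0 := fun z hz h => by
          have hzx : x < z := lt_of_le_of_ne hz.1 fun h' => hxp (h' ▸ h)
          have hzy : z < y := lt_of_le_of_ne hz.2 fun h' => hyp (h' ▸ h)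
          have h1 : l z ≤ x := not_lt.1 fun h' => absurd ((hlx z h).trans hzy)
            (not_lt.2 (hno _ (lR h) h'))
          have h1' : l z < x := lt_of_le_of_ne h1 fun h' => hxg (h' ▸ hlg z h)
          have h2 : y ≤ r z := hno _ (rR h) (hzx.trans (hrx z h))
          have h2' : y < r z := lt_of_le_of_ne h2 fun h' => hyg (h' ▸ hrg z h)
          rcases hs' z h with h3 | h3
          · exact hxp (h3.2.2 x hzx (fun w hw => hl z h w ⟨h1'.trans_le hw.1, hw.2⟩) hx0)
          · exact hyp (h3.2.2 y hzy (fun w hw => hr z h w ⟨hw.1, hw.2.trans_lt h2'⟩) hy0)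
        have hg0 := hfree hp0 hxg hyg
        obtain ⟨z, hz, h⟩ := exists_numQ_gaussDeriv_eq_zero a b hxy hp0 hg0 hx0 hy0
        exact ⟨z, hz, h, hg0 z (Ioo_subset_Icc_self hz)⟩
      · have h1 : l v ≤ x := not_lt.1 fun h => absurd (hls v hv) (not_lt.2 (hno _ (lR hv) h))
        have h1' : l v < x := lt_of_le_of_ne h1 fun h => hxg (h ▸ hlg v hv)
        have hxr : x < r v := hxy.trans (hsr v hv)
        rcases hs' v hv with h3 | h3
        · exact absurd (h3.2.2 x (hxy.trans h3.1)
            (fun w hw => hl v hv w ⟨h1'.trans_le hw.1, hw.2⟩) hx0) hxp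
        · rcases lt_trichotomy x v with h | rfl | h
          · exact exists_numQ_gaussDeriv_zero_of_root_mem_Ioo' ha hp hv h3.1 (hs v hv) h
              (fun w hw => hl v hv w ⟨h1'.trans_le hw.1, hw.2⟩) hx0
          · exact absurd hv hxp
          · exact absurd (h3.2.2 x h (fun w hw => hr v hv w ⟨hw.1, hw.2.trans_lt hxr⟩) hx0) hxp
    · rcases hy with rfl | rfl | hy | ⟨v, hv, rfl⟩
      · exact absurd (hkmF _ (hFs hu)) hxy.not_gt
      · exact absurd (hkpF _ (hFR (rR hu))) (not_lt.2 (hno _ (rR hu) (hsr u hu)))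
      · obtain ⟨hy0, hyp, hyg⟩ := mS.1 hy
        have h2 : y ≤ r u := hno _ (rR hu) (hsr u hu)
        have h2' : y < r u := lt_of_le_of_ne h2 fun h' => hyg (h' ▸ hrg u hu)
        have hly : l u < y := (hls u hu).trans hxy
        rcases hs' u hu with h3 | h3
        · rcases lt_trichotomy u y with h | rfl | h
          · exact exists_numQ_gaussDeriv_zero_of_root_mem_Ioo ha hp hu h3.1 (hs u hu) h
              (fun w hw => hr u hu w ⟨hw.1, hw.2.trans_lt h2'⟩) hy0
          · exact absurd hu hyp
          · exact absurd (h3.2.2 y h (fun w hw => hl u hu w ⟨hly.trans_le hw.1, hw.2⟩) hy0) hyp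
        · exact absurd (h3.2.2 y (h3.1.trans hxy)
            (fun w hw => hr u hu w ⟨hw.1, hw.2.trans_lt h2'⟩) hy0) hyp
      · rcases lt_trichotomy u v with h | rfl | h
        · exact absurd ((hrl u v hu hv h).trans_lt (hls v hv))
            (not_lt.2 (hno _ (rR hu) (hsr u hu)))
        · exact absurd hxy (lt_irrefl _)
        · exact absurd (hss v u hv hu h) hxy.not_gt
  have hcard : S.card = S₀.card + p.roots.toFinset.card + 2 := by
    have hinj : Set.InjOn s (p.roots.toFinset : Set ℝ) := fun u hu v hv huv => by
      have hu := mA.1 hu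
      have hv := mA.1 hv
      rcases lt_trichotomy u v with h | h | h
      · exact absurd huv (hss u v hu hv h).ne
      · exact h
      · exact absurd huv (hss v u hv hu h).ne'
    have hdisj : Disjoint S₀ (p.roots.toFinset.image s) := by
      rw [Finset.disjoint_right]
      intro x hx
      obtain ⟨u, hu, rfl⟩ := Finset.mem_image.1 hx
      exact hsS u (mA.1 hu)
    have hkk : km < kp := by
      obtain ⟨z, hz⟩ := hRne
      exact (hkmF z (hFR hz)).trans (hkpF z (hFR hz))
    have h1 : kp ∉ S₀ ∪ p.roots.toFinset.image s := fun h =>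
      lt_irrefl _ (hkpF kp (Finset.mem_union_left _ h))
    have h2 : km ∉ insert kp (S₀ ∪ p.roots.toFinset.image s) := fun h => by
      rcases Finset.mem_insert.1 h with h | h
      · exact hkk.ne h
      · exact lt_irrefl _ (hkmF km (Finset.mem_union_left _ h))
    rw [hS, Finset.card_insert_of_notMem h2, Finset.card_insert_of_notMem h1,
      Finset.card_union_of_disjoint hdisj, Finset.card_image_of_injOn hinj]
  have hsub : (R ∪ Z) \ S ⊆ R ∪ (Z \ S₀) := fun x hx => by
    simp only [Finset.mem_sdiff, Finset.mem_union, hS, Finset.mem_insert, not_or] at hx ⊢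
    exact hx.1.imp id fun h => ⟨h, hx.2.2.2.1⟩
  have := (Finset.card_le_card hsub).trans (Finset.card_union_le _ _)
  omega

theorem card_rootsAwayFrom_gaussDeriv_le (b : ℝ) (ha : 0 < a) (hp : p ≠ 0) :
    (rootsAwayFrom (gaussDeriv a b p) p).card ≤
      (rootsAwayFrom (numQ a p) (p * gaussDeriv a b p)).card + p.roots.toFinset.card + 1 := by
  classical
  have hg := gaussDeriv_ne_zero b ha hp
  have hW := numQ_ne_zero ha hp
  have h : (rootsAwayFrom (gaussDeriv a b p) p).card ≤
      (rootsAwayFrom (numQ a p) (p * gaussDeriv a b p) ∪ p.roots.toFinset).card + 1 := by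
    refine Finset.card_le_of_interleaved fun x hx y hy hxy hno => ?_
    rw [mem_rootsAwayFrom hg] at hx hy
    by_cases hroot : ∃ z ∈ Icc x y, p.eval z = 0
    · obtain ⟨z, hz, h⟩ := hroot
      exact ⟨z, Finset.mem_union_right _ (by simp [hp, h]),
        lt_of_le_of_ne hz.1 fun h' => hx.2 (h' ▸ h), lt_of_le_of_ne hz.2 fun h' => hy.2 (h' ▸ h)⟩
    · push Not at hroot
      obtain ⟨z, hz, h⟩ := exists_numQ_eq_zero a b hxy hroot hx.1 hy.1
      have hpz := hroot z (Ioo_subset_Icc_self hz)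
      refine ⟨z, Finset.mem_union_left _ ((mem_rootsAwayFrom hW).2 ⟨h, ?_⟩), hz⟩
      rw [eval_mul]
      exact mul_ne_zero hpz fun h0 => hno z ((mem_rootsAwayFrom hg).2 ⟨h0, hpz⟩) hz
  have := Finset.card_union_le (rootsAwayFrom (numQ a p) (p * gaussDeriv a b p)) p.roots.toFinset
  omega

/-- The number of roots of `f` that are not roots of `g`, counted with their multiplicities as
roots of `f`. -/
noncomputable def countAwayFrom (f g : ℝ[X]) : ℕ :=
  ∑ x ∈ rootsAwayFrom f g, f.rootMultiplicity x

theorem countAwayFrom_numQ_add (b : ℝ) (ha : 0 < a) (hp : p ≠ 0) :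
    countAwayFrom (numQ a p) p + (rootsAwayFrom (gaussDeriv a b p) p).card =
      (∑ x ∈ rootsAwayFrom (numQ a p) (p * gaussDeriv a b p), (numQ a p).rootMultiplicity x) +
        countAwayFrom (gaussDeriv a b p) p := by
  classical
  have hg := gaussDeriv_ne_zero b ha hp
  have hW := numQ_ne_zero ha hp
  have h1 : countAwayFrom (gaussDeriv a b p) p =
      (∑ x ∈ rootsAwayFrom (gaussDeriv a b p) p, (numQ a p).rootMultiplicity x) +
        (rootsAwayFrom (gaussDeriv a b p) p).card := by
    rw [countAwayFrom, Finset.card_eq_sum_ones, ← Finset.sum_add_distrib]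
    refine Finset.sum_congr rfl fun x hx => ?_
    rw [mem_rootsAwayFrom hg] at hx
    exact (rootMultiplicity_numQ_of_gaussDeriv_root b ha hp hx.2 hx.1).symm
  have h2 : countAwayFrom (numQ a p) p =
      (∑ x ∈ rootsAwayFrom (numQ a p) (p * gaussDeriv a b p), (numQ a p).rootMultiplicity x) +
        ∑ x ∈ rootsAwayFrom (gaussDeriv a b p) p, (numQ a p).rootMultiplicity x := by
    have hdisj : Disjoint (rootsAwayFrom (numQ a p) (p * gaussDeriv a b p))
        (rootsAwayFrom (gaussDeriv a b p) p) := by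
      rw [Finset.disjoint_left]
      intro x hx hx'
      rw [mem_rootsAwayFrom hW, eval_mul] at hx
      rw [mem_rootsAwayFrom hg] at hx'
      exact hx.2 (by rw [hx'.1, mul_zero])
    rw [countAwayFrom, ← Finset.sum_union hdisj]
    refine Finset.sum_subset (fun x hx => ?_) fun x hx hx' => ?_
    · rw [mem_rootsAwayFrom hW] at hx
      rw [Finset.mem_union, mem_rootsAwayFrom hW, mem_rootsAwayFrom hg, eval_mul, mul_ne_zero_iff]
      tauto
    · rw [Finset.mem_union, mem_rootsAwayFrom hW, mem_rootsAwayFrom hg, eval_mul,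
        mul_ne_zero_iff] at hx
      rw [mem_rootsAwayFrom hW] at hx'
      exact rootMultiplicity_eq_zero fun h => by
        rw [IsRoot.def] at h
        tauto
  omega

theorem countAwayFrom_gaussDeriv_le (b : ℝ) (ha : 0 < a) (hp : p ≠ 0) :
    countAwayFrom (gaussDeriv a b p) p ≤
      countAwayFrom (numQ a p) p + p.roots.toFinset.card + 1 := by
  have h1 := countAwayFrom_numQ_add b ha hp
  have h2 := card_rootsAwayFrom_gaussDeriv_le b ha hp
  have h3 : (rootsAwayFrom (numQ a p) (p * gaussDeriv a b p)).card ≤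
      ∑ x ∈ rootsAwayFrom (numQ a p) (p * gaussDeriv a b p), (numQ a p).rootMultiplicity x := by
    have hW := numQ_ne_zero ha hp
    rw [Finset.card_eq_sum_ones]
    refine Finset.sum_le_sum fun x hx => ?_
    exact (rootMultiplicity_pos hW).2 ((mem_rootsAwayFrom hW).1 hx).1
  omega

theorem countAwayFrom_numQ_le (ha : 0 < a) (hp : p ≠ 0) (hA : PolyPropertyA a b p) :
    countAwayFrom (numQ a p) p + p.roots.toFinset.card + 1 ≤
      countAwayFrom (gaussDeriv a b p) p +
        countAwayFrom (numQ a (gaussDeriv a b p)) (gaussDeriv a b p) := by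
  classical
  have hg := gaussDeriv_ne_zero b ha hp
  have hW := numQ_ne_zero ha hp
  have hW1 := numQ_ne_zero ha hg
  have h1 := countAwayFrom_numQ_add b ha hp
  have h2 := card_zeros_numQ_add_le ha hp hA
  set S₀ := rootsAwayFrom (numQ a p) (p * gaussDeriv a b p) with hS₀
  set Z := rootsAwayFrom (numQ a (gaussDeriv a b p)) (gaussDeriv a b p) with hZ
  have h3 : ∑ x ∈ S₀, (numQ a p).rootMultiplicity x ≤
      (∑ x ∈ S₀, (numQ a (gaussDeriv a b p)).rootMultiplicity x) + S₀.card := by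
    rw [Finset.card_eq_sum_ones, ← Finset.sum_add_distrib]
    refine Finset.sum_le_sum fun x hx => ?_
    rw [hS₀, mem_rootsAwayFrom hW, eval_mul, mul_ne_zero_iff] at hx
    exact rootMultiplicity_numQ_le b ha hp hx.2.1
  have h4 : (Z \ S₀).card ≤ ∑ x ∈ Z \ S₀, (numQ a (gaussDeriv a b p)).rootMultiplicity x := by
    rw [Finset.card_eq_sum_ones]
    refine Finset.sum_le_sum fun x hx => ?_
    exact (rootMultiplicity_pos hW1).2 ((mem_rootsAwayFrom hW1).1 (Finset.mem_sdiff.1 hx).1).1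
  have h5 : (∑ x ∈ S₀, (numQ a (gaussDeriv a b p)).rootMultiplicity x) +
      ∑ x ∈ Z \ S₀, (numQ a (gaussDeriv a b p)).rootMultiplicity x =
      countAwayFrom (numQ a (gaussDeriv a b p)) (gaussDeriv a b p) := by
    rw [countAwayFrom, ← hZ, ← Finset.sum_union Finset.disjoint_sdiff]
    refine (Finset.sum_subset (fun x hx => ?_) fun x hx hx' => ?_).symm
    · simp [hx]
    · have hxS : x ∈ S₀ := by simpa [hx'] using hx
      rw [hS₀, mem_rootsAwayFrom hW, eval_mul, mul_ne_zero_iff] at hxS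
      rw [hZ, mem_rootsAwayFrom hW1] at hx'
      exact rootMultiplicity_eq_zero fun h => hx' ⟨h, hxS.2.2⟩
  omega

theorem odd_countAwayFrom_gaussDeriv_add (b : ℝ) (ha : 0 < a) (hp : p ≠ 0) :
    Odd (countAwayFrom (gaussDeriv a b p) p + p.roots.toFinset.card) := by
  classical
  have hg := gaussDeriv_ne_zero b ha hp
  have h1 := even_card_roots_add_natDegree hp
  have h2 := even_card_roots_add_natDegree hg
  rw [natDegree_gaussDeriv b ha hp] at h2
  have h3 : (gaussDeriv a b p).roots.card + p.roots.toFinset.card =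
      countAwayFrom (gaussDeriv a b p) p + p.roots.card := by
    have e1 : p.roots.card = (∑ x ∈ p.roots.toFinset, (gaussDeriv a b p).rootMultiplicity x) +
        p.roots.toFinset.card := by
      rw [← Multiset.toFinset_sum_count_eq, Finset.card_eq_sum_ones, ← Finset.sum_add_distrib]
      refine Finset.sum_congr rfl fun x hx => ?_
      rw [count_roots]
      exact (rootMultiplicity_gaussDeriv a b hp (by simpa [hp] using hx)).symm
    have e2 : (gaussDeriv a b p).roots.card = countAwayFrom (gaussDeriv a b p) p +
        ∑ x ∈ p.roots.toFinset, (gaussDeriv a b p).rootMultiplicity x := by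
      have hdisj : Disjoint (rootsAwayFrom (gaussDeriv a b p) p) p.roots.toFinset := by
        rw [Finset.disjoint_left]
        intro x hx hx'
        exact ((mem_rootsAwayFrom hg).1 hx).2 (by simpa [hp] using hx')
      rw [← Multiset.toFinset_sum_count_eq, countAwayFrom, ← Finset.sum_union hdisj]
      simp only [count_roots]
      refine Finset.sum_subset (fun x hx => ?_) fun x hx hx' => ?_
      · have hx : (gaussDeriv a b p).eval x = 0 := by simpa [hg] using hx
        rw [Finset.mem_union, mem_rootsAwayFrom hg]
        by_cases h : p.eval x = 0
        · exact Or.inr (by simp [hp, h])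
        · exact Or.inl ⟨hx, h⟩
      · exact rootMultiplicity_eq_zero fun h => hx' (by simp [hg, h.eq_zero])
    omega
  rw [Nat.odd_iff]
  rw [Nat.even_iff] at h1 h2
  omega

end Counting

section Meromorphic

open Filter Topology

variable {a b : ℝ} {p : ℝ[X]}

theorem analyticAt_eval (p : ℝ[X]) (x : ℝ) : AnalyticAt ℝ (fun y => p.eval y) x :=
  AnalyticOnNhd.eval_polynomial p x trivial

theorem meromorphicOrderAt_gaussPoly (a b : ℝ) (hp : p ≠ 0) (x : ℝ) :
    meromorphicOrderAt (gaussPoly a b p) x = ((p.rootMultiplicity x : ℤ) : WithTop ℤ) := by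
  have hmer : AnalyticAt ℝ (gaussPoly a b p) x := by
    unfold gaussPoly
    exact (AnalyticAt.rexp (by fun_prop)).mul (analyticAt_eval p x)
  obtain ⟨q, hq, hqx⟩ := exists_eq_pow_rootMultiplicity_mul hp x
  rw [meromorphicOrderAt_eq_int_iff hmer.meromorphicAt]
  refine ⟨gaussPoly a b q, ?_, by rwa [Ne, gaussPoly_eq_zero_iff], Eventually.of_forall fun z => ?_⟩
  · unfold gaussPoly
    exact (AnalyticAt.rexp (by fun_prop)).mul (analyticAt_eval q x)
  · simp only [gaussPoly, zpow_natCast, smul_eq_mul]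
    conv_lhs => rw [hq]
    simp only [eval_mul, eval_pow, eval_sub, eval_X, eval_C]
    ring

theorem vanishesAt_gaussPoly_iff (a b : ℝ) (hp : p ≠ 0) {x : ℝ} :
    VanishesAt (gaussPoly a b p) x ↔ p.eval x = 0 := by
  rw [VanishesAt, meromorphicOrderAt_gaussPoly a b hp, ← IsRoot.def, ← rootMultiplicity_pos hp]
  norm_cast

theorem zeroMultiplicity_gaussPoly (a b : ℝ) (hp : p ≠ 0) (x : ℝ) :
    zeroMultiplicity (gaussPoly a b p) x = p.rootMultiplicity x := by
  rw [zeroMultiplicity, meromorphicOrderAt_gaussPoly a b hp, WithTop.untop₀_coe, Int.toNat_natCast]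

theorem eventually_eval_ne_zero (hp : p ≠ 0) (x : ℝ) : ∀ᶠ y in 𝓝[≠] x, p.eval y ≠ 0 := by
  have h : ({y | p.eval y = 0} \ {x}).Finite :=
    (p.roots.toFinset.finite_toSet.subset fun y hy => by simpa [hp] using hy).subset
      Set.sdiff_subset
  filter_upwards [nhdsWithin_le_nhds (h.isClosed.compl_mem_nhds fun hx => hx.2 rfl),
    self_mem_nhdsWithin] with y hy hyx h0
  exact hy ⟨h0, hyx⟩

theorem logDerivDeriv_gaussPoly {x : ℝ} (hx : p.eval x ≠ 0) :
    logDerivDeriv (gaussPoly a b p) x = (numQ a p).eval x / p.eval x ^ 2 := by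
  have h : (fun x => deriv (gaussPoly a b p) x / gaussPoly a b p x) =
      fun x => (gaussDeriv a b p).eval x / p.eval x := by
    funext y
    rw [deriv_gaussPoly, gaussPoly, gaussPoly, mul_div_mul_left _ _ (Real.exp_ne_zero _)]
  rw [logDerivDeriv, h, (hasDerivAt_gaussDeriv_div a b p hx).deriv]

theorem meromorphicOrderAt_logDerivDeriv_gaussPoly (b : ℝ) (ha : 0 < a) (hp : p ≠ 0) (x : ℝ) :
    meromorphicOrderAt (logDerivDeriv (gaussPoly a b p)) x =
      (((numQ a p).rootMultiplicity x - 2 * p.rootMultiplicity x : ℤ) : WithTop ℤ) := by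
  have hW := numQ_ne_zero ha hp
  obtain ⟨q, hq, hqx⟩ := exists_eq_pow_rootMultiplicity_mul hp x
  obtain ⟨r, hr, hrx⟩ := exists_eq_pow_rootMultiplicity_mul hW x
  have hmer : MeromorphicAt (fun y => (numQ a p).eval y / p.eval y ^ 2) x :=
    (analyticAt_eval (numQ a p) x).meromorphicAt.div
      ((analyticAt_eval p x).meromorphicAt.pow 2)
  rw [meromorphicOrderAt_congr ((eventually_eval_ne_zero hp x).mono fun y hy =>
    logDerivDeriv_gaussPoly hy), meromorphicOrderAt_eq_int_iff hmer]
  refine ⟨fun y => r.eval y / q.eval y ^ 2, (analyticAt_eval r x).div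
    ((analyticAt_eval q x).pow 2) (pow_ne_zero 2 hqx), div_ne_zero hrx (pow_ne_zero 2 hqx),
    ?_⟩
  filter_upwards [self_mem_nhdsWithin] with y hy
  have hyx : y - x ≠ 0 := sub_ne_zero.2 hy
  rw [zpow_sub₀ hyx, zpow_natCast, mul_comm (2 : ℤ), zpow_mul, zpow_natCast, zpow_ofNat,
    smul_eq_mul]
  conv_lhs => rw [hr]; enter [2]; rw [hq]
  simp only [eval_mul, eval_pow, eval_sub, eval_X, eval_C]
  rw [mul_pow, mul_div_mul_comm]

theorem zeroMultiplicity_logDerivDeriv_gaussPoly (b : ℝ) (ha : 0 < a) (hp : p ≠ 0) (x : ℝ) :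
    zeroMultiplicity (logDerivDeriv (gaussPoly a b p)) x =
      (numQ a p).rootMultiplicity x - 2 * p.rootMultiplicity x := by
  rw [zeroMultiplicity, meromorphicOrderAt_logDerivDeriv_gaussPoly b ha hp, WithTop.untop₀_coe]
  omega

theorem rootMultiplicity_numQ_lt (a : ℝ) (hp : p ≠ 0) {x : ℝ} (hx : p.eval x = 0) :
    (numQ a p).rootMultiplicity x < 2 * p.rootMultiplicity x := by
  obtain ⟨k, r, s, t, hk, ⟨h1, h2⟩, -⟩ := factor_at_root a 0 hp hx
  rw [hk, rootMultiplicity_eq_of_eq_pow_mul h1 h2.ne]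
  omega

theorem vanishesAt_logDerivDeriv_gaussPoly_iff (b : ℝ) (ha : 0 < a) (hp : p ≠ 0) {x : ℝ} :
    VanishesAt (logDerivDeriv (gaussPoly a b p)) x ↔
      (numQ a p).eval x = 0 ∧ p.eval x ≠ 0 := by
  rw [VanishesAt, meromorphicOrderAt_logDerivDeriv_gaussPoly b ha hp, ← IsRoot.def,
    ← rootMultiplicity_pos (numQ_ne_zero ha hp), ← WithTop.coe_zero, WithTop.coe_lt_coe]
  by_cases hx : p.eval x = 0
  · have := rootMultiplicity_numQ_lt a hp hx
    simp only [hx, ne_eq, not_true_eq_false, and_false, iff_false]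
    omega
  · rw [rootMultiplicity_eq_zero hx]
    simp [hx]

theorem zeroCount_logDerivDeriv_gaussPoly (b : ℝ) (ha : 0 < a) (hp : p ≠ 0) :
    zeroCount (logDerivDeriv (gaussPoly a b p)) Set.univ = countAwayFrom (numQ a p) p := by
  have hW := numQ_ne_zero ha hp
  rw [zeroCount, countAwayFrom,
    finsum_mem_eq_sum_of_inter_support_eq (t := rootsAwayFrom (numQ a p) p)]
  · refine Finset.sum_congr rfl fun x hx => ?_
    rw [zeroMultiplicity_logDerivDeriv_gaussPoly b ha hp,
      rootMultiplicity_eq_zero ((mem_rootsAwayFrom hW).1 hx).2]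
    rfl
  · ext x
    simp only [Set.univ_inter, Function.mem_support, Set.mem_inter_iff, Finset.mem_coe,
      iff_and_self, mem_rootsAwayFrom hW, zeroMultiplicity_logDerivDeriv_gaussPoly b ha hp]
    intro h
    refine ⟨(rootMultiplicity_pos hW).1 (by omega), fun h0 => ?_⟩
    have := rootMultiplicity_numQ_lt a hp h0
    omega

theorem hasPropertyA_gaussPoly (ha : 0 < a) (hp : p ≠ 0)
    (hA : HasPropertyA (gaussPoly a b p)) : PolyPropertyA a b p := by
  intro x hx
  have h := hA x (gaussPoly_eq_zero_iff.2 hx)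
  simp only [HasPropertyAAt, leftGap, rightGap, Set.mem_ofPred_eq,
    vanishesAt_logDerivDeriv_gaussPoly_iff b ha hp, deriv_gaussPoly, ne_eq,
    gaussPoly_eq_zero_iff] at h
  refine h.imp (fun h y hy h1 h2 => ?_) fun h y hy h1 h2 => ?_
  · exact not_not.1 fun h3 => h y ⟨hy, h1⟩ ⟨h2, h3⟩
  · exact not_not.1 fun h3 => h y ⟨hy, h1⟩ ⟨h2, h3⟩

end Meromorphic

section ExtraZeros

open Set

variable {a b : ℝ} {p : ℝ[X]}

theorem zeroCount_gaussPoly (a b : ℝ) (hp : p ≠ 0) (S : Set ℝ) [DecidablePred (· ∈ S)] :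
    zeroCount (gaussPoly a b p) S =
      ∑ x ∈ p.roots.toFinset.filter (· ∈ S), p.rootMultiplicity x := by
  rw [zeroCount, finsum_mem_eq_sum_of_inter_support_eq
    (t := p.roots.toFinset.filter (· ∈ S))]
  · simp only [zeroMultiplicity_gaussPoly a b hp]
  · ext x
    simp only [mem_inter_iff, Function.mem_support, zeroMultiplicity_gaussPoly a b hp,
      Finset.coe_filter, Multiset.mem_toFinset, mem_ofPred_eq, mem_roots hp,
      ← rootMultiplicity_pos hp, pos_iff_ne_zero]
    tauto

theorem extraZeros_of_no_root (b : ℝ) (ha : 0 < a) (hp : p ≠ 0) (h : ∀ x, p.eval x ≠ 0) :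
    extraZeros (gaussPoly a b p) = countAwayFrom (gaussDeriv a b p) p := by
  have hg := gaussDeriv_ne_zero b ha hp
  have h1 : consecutiveZeros (gaussPoly a b p) = ∅ := by
    ext x
    simp [consecutiveZeros, gaussPoly_eq_zero_iff, h]
  have h2 : outerPoints (gaussPoly a b p) = univ := by
    ext x
    simp [outerPoints, gaussPoly_eq_zero_iff, h]
  rw [extraZeros, h1, h2, finsum_mem_empty, zero_add, deriv_gaussPoly, zeroCount_gaussPoly a b hg,
    countAwayFrom, rootsAwayFrom]
  simp [h]

theorem extraZeros_add_card_roots (b : ℝ) (ha : 0 < a) (hp : p ≠ 0) (h : ∃ x, p.eval x = 0) :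
    extraZeros (gaussPoly a b p) + p.roots.toFinset.card =
      countAwayFrom (gaussDeriv a b p) p + 1 := by
  classical
  have hg := gaussDeriv_ne_zero b ha hp
  set g := gaussDeriv a b p with hgdef
  set A := p.roots.toFinset with hA
  have mA : ∀ {x}, x ∈ A ↔ p.eval x = 0 := fun {x} => by simp [hA, hp]
  have hne : A.Nonempty := h.imp fun x hx => mA.2 hx
  set C : Finset (ℝ × ℝ) := (A ×ˢ A).filter (· ∈ consecutiveZeros (gaussPoly a b p)) with hC
  have mC : ∀ {u}, u ∈ C ↔ u.1 < u.2 ∧ p.eval u.1 = 0 ∧ p.eval u.2 = 0 ∧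
      ∀ x ∈ Ioo u.1 u.2, p.eval x ≠ 0 := fun {u} => by
    simp only [hC, Finset.mem_filter, Finset.mem_product, mA, consecutiveZeros, mem_ofPred_eq,
      gaussPoly_eq_zero_iff, ne_eq]
    tauto
  have hCset : consecutiveZeros (gaussPoly a b p) = C := by
    ext u
    rw [Finset.mem_coe, mC]
    simp only [consecutiveZeros, mem_ofPred_eq, gaussPoly_eq_zero_iff, ne_eq]
  have hCcard : C.card + 1 = A.card := by
    rw [← Finset.card_erase_add_one (A.max'_mem hne)]
    congr 1
    refine Finset.card_bij (fun u _ => u.1) (fun u hu => ?_) (fun u hu v hv huv => ?_)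
      fun x hx => ?_
    · have hu := mC.1 hu
      exact Finset.mem_erase.2 ⟨(hu.1.trans_le (A.le_max' _ (mA.2 hu.2.2.1))).ne, mA.2 hu.2.1⟩
    · have hu := mC.1 hu
      have hv := mC.1 hv
      refine Prod.ext huv (le_antisymm (not_lt.1 fun hlt => ?_) (not_lt.1 fun hlt => ?_))
      · exact hu.2.2.2 v.2 ⟨huv ▸ hv.1, hlt⟩ hv.2.2.1
      · exact hv.2.2.2 u.2 ⟨huv ▸ hu.1, hlt⟩ hu.2.2.1
    · obtain ⟨hx1, hx2⟩ := Finset.mem_erase.1 hx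
      obtain ⟨y, hy, hxy, hmin⟩ := Finset.exists_next_right
        ⟨A.max' hne, A.max'_mem hne, lt_of_le_of_ne (A.le_max' _ hx2) hx1⟩
      exact ⟨(x, y), mC.2 ⟨hxy, mA.1 hx2, mA.1 hy, fun z hz h0 =>
        not_lt.2 (hmin z (mA.2 h0) hz.1) hz.2⟩, rfl⟩
  have hpos : ∀ u ∈ C, 1 ≤ zeroCount (gaussPoly a b g) (Ioo u.1 u.2) := fun u hu => by
    have hu := mC.1 hu
    obtain ⟨z, hz, hz0⟩ := exists_gaussDeriv_eq_zero a b hu.1 hu.2.1 hu.2.2.1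
    rw [zeroCount_gaussPoly a b hg]
    have hz1 : 1 ≤ g.rootMultiplicity z := (rootMultiplicity_pos hg).2 hz0
    refine hz1.trans (Finset.single_le_sum (f := fun x => g.rootMultiplicity x)
      (fun _ _ => Nat.zero_le _) ?_)
    rw [Finset.mem_filter, Multiset.mem_toFinset, mem_roots hg]
    exact ⟨hz0, hz⟩
  have hsum : (∑ᶠ u ∈ consecutiveZeros (gaussPoly a b p),
      (zeroCount (gaussPoly a b g) (Ioo u.1 u.2) - 1)) + C.card =
      ∑ u ∈ C, zeroCount (gaussPoly a b g) (Ioo u.1 u.2) := by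
    rw [hCset, finsum_mem_coe_finset, Finset.card_eq_sum_ones, ← Finset.sum_add_distrib]
    exact Finset.sum_congr rfl fun u hu => Nat.sub_add_cancel (hpos u hu)
  have hunion : rootsAwayFrom g p =
      (C.biUnion fun u => g.roots.toFinset.filter (· ∈ Ioo u.1 u.2)) ∪
        g.roots.toFinset.filter (· ∈ outerPoints (gaussPoly a b p)) := by
    ext x
    simp only [mem_rootsAwayFrom hg, Finset.mem_union, Finset.mem_biUnion, Finset.mem_filter,
      Multiset.mem_toFinset, mem_roots hg, IsRoot.def, outerPoints, mem_ofPred_eq,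
      gaussPoly_eq_zero_iff]
    constructor
    · rintro ⟨hx, hpx⟩
      by_cases ho : (∀ y, p.eval y = 0 → x < y) ∨ (∀ y, p.eval y = 0 → y < x)
      · exact Or.inr ⟨hx, ho⟩
      · push Not at ho
        obtain ⟨⟨y, hy, hyx⟩, z, hz, hxz⟩ := ho
        have hyx : y < x := lt_of_le_of_ne hyx fun h => hpx (h ▸ hy)
        have hxz : x < z := lt_of_le_of_ne hxz fun h => hpx (h ▸ hz)
        obtain ⟨v, hv, hxv, hmin⟩ := Finset.exists_next_right ⟨z, mA.2 hz, hxz⟩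
        obtain ⟨u, hu, hux, hmax⟩ := Finset.exists_next_left ⟨y, mA.2 hy, hyx⟩
        refine Or.inl ⟨(u, v), mC.2 ⟨hux.trans hxv, mA.1 hu, mA.1 hv, fun w hw h0 => ?_⟩, hx,
          hux, hxv⟩
        rcases lt_trichotomy w x with h | rfl | h
        · exact not_lt.2 (hmax w (mA.2 h0) h) hw.1
        · exact hpx h0
        · exact not_lt.2 (hmin w (mA.2 h0) h) hw.2
    · rintro (⟨u, hu, hx, hxu⟩ | ⟨hx, ho⟩)
      · exact ⟨hx, (mC.1 hu).2.2.2 x hxu⟩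
      · exact ⟨hx, fun h0 => ho.elim (fun h => lt_irrefl _ (h x h0)) fun h =>
          lt_irrefl _ (h x h0)⟩
  have hdisj : Disjoint (C.biUnion fun u => g.roots.toFinset.filter (· ∈ Ioo u.1 u.2))
      (g.roots.toFinset.filter (· ∈ outerPoints (gaussPoly a b p))) := by
    rw [Finset.disjoint_left]
    intro x hx hx'
    obtain ⟨u, hu, hxu⟩ := Finset.mem_biUnion.1 hx
    have hu := mC.1 hu
    have hxu := (Finset.mem_filter.1 hxu).2
    rcases (Finset.mem_filter.1 hx').2 with h | h
    · exact lt_asymm hxu.1 (h u.1 (gaussPoly_eq_zero_iff.2 hu.2.1))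
    · exact lt_asymm hxu.2 (h u.2 (gaussPoly_eq_zero_iff.2 hu.2.2.1))
  have hpair : (C : Set (ℝ × ℝ)).PairwiseDisjoint
      fun u => g.roots.toFinset.filter (· ∈ Ioo u.1 u.2) := by
    intro u hu v hv huv
    rw [Function.onFun, Finset.disjoint_left]
    intro x hxu hxv
    have hxu := (Finset.mem_filter.1 hxu).2
    have hxv := (Finset.mem_filter.1 hxv).2
    have hu := mC.1 hu
    have hv := mC.1 hv
    refine huv (Prod.ext (le_antisymm ?_ ?_) (le_antisymm ?_ ?_))
    · exact not_lt.1 fun h => hv.2.2.2 u.1 ⟨h, hxu.1.trans hxv.2⟩ hu.2.1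
    · exact not_lt.1 fun h => hu.2.2.2 v.1 ⟨h, hxv.1.trans hxu.2⟩ hv.2.1
    · exact not_lt.1 fun h => hu.2.2.2 v.2 ⟨hxu.1.trans hxv.2, h⟩ hv.2.2.1
    · exact not_lt.1 fun h => hv.2.2.2 u.2 ⟨hxv.1.trans hxu.2, h⟩ hu.2.2.1
  have hcount : countAwayFrom g p = (∑ u ∈ C, zeroCount (gaussPoly a b g) (Ioo u.1 u.2)) +
      zeroCount (gaussPoly a b g) (outerPoints (gaussPoly a b p)) := by
    rw [countAwayFrom, hunion, Finset.sum_union hdisj, Finset.sum_biUnion hpair]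
    simp only [zeroCount_gaussPoly a b hg]
  rw [extraZeros, deriv_gaussPoly, ← hgdef]
  omega

end ExtraZeros

theorem mainTheorem7 (a b : ℝ) (ha : 0 < a) (p : ℝ[X]) (hp : p ≠ 0)
    (hA : HasPropertyA (gaussPoly a b p)) :
    -- the numbers below are finite
    ({x : ℝ | VanishesAt (deriv (gaussPoly a b p)) x}.Finite ∧
      {x : ℝ | VanishesAt (logDerivDeriv (gaussPoly a b p)) x}.Finite ∧
      {x : ℝ | VanishesAt (logDerivDeriv (deriv (gaussPoly a b p))) x}.Finite) ∧
    ((∀ x : ℝ, p.eval x ≠ 0) →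
      2 * ((extraZeros (gaussPoly a b p) / 2 : ℕ) : ℤ) ≤
          (zeroCount (logDerivDeriv (gaussPoly a b p)) Set.univ : ℤ) ∧
        (zeroCount (logDerivDeriv (gaussPoly a b p)) Set.univ : ℤ) ≤
          2 * ((extraZeros (gaussPoly a b p) / 2 : ℕ) : ℤ) +
            (zeroCount (logDerivDeriv (deriv (gaussPoly a b p))) Set.univ : ℤ)) ∧
    ((∃ x : ℝ, p.eval x = 0) →
      2 * ((extraZeros (gaussPoly a b p) / 2 : ℕ) : ℤ) - 2 ≤
          (zeroCount (logDerivDeriv (gaussPoly a b p)) Set.univ : ℤ) ∧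
        (zeroCount (logDerivDeriv (gaussPoly a b p)) Set.univ : ℤ) ≤
          2 * ((extraZeros (gaussPoly a b p) / 2 : ℕ) : ℤ) - 2 +
            (zeroCount (logDerivDeriv (deriv (gaussPoly a b p))) Set.univ : ℤ)) := by
  have hg := gaussDeriv_ne_zero b ha hp
  have hfin : ∀ f : ℝ[X], f ≠ 0 → {x : ℝ | f.eval x = 0}.Finite := fun f hf =>
    f.roots.toFinset.finite_toSet.subset fun x hx => by simpa [hf] using hx
  have hlow := countAwayFrom_gaussDeriv_le b ha hp
  have hupp := countAwayFrom_numQ_le ha hp (hasPropertyA_gaussPoly ha hp hA)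
  have hodd := Nat.odd_iff.1 (odd_countAwayFrom_gaussDeriv_add b ha hp)
  rw [zeroCount_logDerivDeriv_gaussPoly b ha hp]
  refine ⟨⟨?_, ?_, ?_⟩, fun h => ?_, fun h => ?_⟩
  · simpa only [deriv_gaussPoly, vanishesAt_gaussPoly_iff a b hg] using hfin _ hg
  · simp only [vanishesAt_logDerivDeriv_gaussPoly_iff b ha hp]
    exact (hfin _ (numQ_ne_zero ha hp)).subset fun x hx => hx.1
  · simp only [deriv_gaussPoly, vanishesAt_logDerivDeriv_gaussPoly_iff b ha hg]
    exact (hfin _ (numQ_ne_zero ha hg)).subset fun x hx => hx.1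
  · rw [deriv_gaussPoly, zeroCount_logDerivDeriv_gaussPoly b ha hg,
      extraZeros_of_no_root b ha hp h]
    have hA0 : p.roots.toFinset.card = 0 := by
      rw [Finset.card_eq_zero, Finset.eq_empty_iff_forall_notMem]
      intro x hx
      exact h x (by simpa [hp] using hx)
    omega
  · rw [deriv_gaussPoly, zeroCount_logDerivDeriv_gaussPoly b ha hg]
    have hE := extraZeros_add_card_roots b ha hp h
    omega
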